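/- Let $n\ge 2$ and let $M$ be a non-empty $n$-dimensional smooth manifold with an LP-Kenmotsu (Lorentzian para-Kenmotsu) structure $(\varphi,\zeta,\nu,g)$: $g$ is a smooth Lorentzian metric of signature $(-,+,\dots,+)$ with Levi-Civita connection $\nabla$, $\varphi$ is a smooth $(1,1)$-tensor field, $\zeta$ a smooth vector field and $\nu$ a 1-form such that, for all vector fields $E,F$, $$\nu(\zeta)=-1,\quad \varphi^2E=E+\nu(E)\zeta,\quad \varphi\zeta=0,\quad \nu(\varphi E)=0,\quad g(\varphi E,\varphi F)=g(E,F)+\nu(E)\nu(F),$$ $$g(E,\zeta)=\nu(E),\quad g(\varphi E,F)=g(E,\varphi F),\quad (\nabla_E\varphi)F=-g(\varphi E,F)\zeta-\nu(F)\varphi E .$$ Let $S$ be the Ricci tensor and $r$ the scalar curvature of $g$, with the conventions $R(E,F)G=\nabla_E\nabla_FG-\nabla_F\nabla_EG-\nabla_{[E,F]}G$ and $S(F,G)=\operatorname{tr}(E\mapsto R(E,F)G)$, and assume that $r$ is constant. For $\sigma,\rho,\Lambda\in\mathbb R$ and a smooth function $v$ on $M$, the metric $g$ is a gradient Ricci-Yamabe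 soliton with data $(v,\sigma,\rho,\Lambda)$ if $$\nabla^2v+\sigma S+\Big(\Lambda-\frac{\rho r}{2}\Big)g=0,$$ where $\nabla^2 v$ is the Hessian of $v$; it is called shrinking if $\Lambda<0$. It is a gradient Ricci soliton if $(\sigma,\rho)=(1,0)$ and a gradient Einstein soliton if $(\sigma,\rho)=(1,-1)$. Then: 1. If $g$ is a gradient Ricci-Yamabe soliton with data $(v,\sigma,\rho,\Lambda)$ and $\sigma\neq0$, then $(M,g)$ is Einstein, that is, $S=c\,g$ for a constant $c\neq0$, and $$\Lambda=\frac{\rho\,n(n-1)}{2}-\sigma(n-1).$$ 2. If $g$ is a gradient Ricci soliton, then $\Lambda=-(n-1)$, and the soliton is shrinking. 3. If $g$ is a gradient Einstein soliton, then $\Lambda=-\frac{(n-1)(n+2)}{2}$, and the soliton is shrinking. -/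

import Mathlib

open Bundle FiberBundle VectorField
open scoped Manifold ContDiff Topology

noncomputable section

/-- A smooth Lorentzian metric on `M`, of signature `(-, +, …, +)`: at every point some vector is
timelike and the metric is positive definite on its orthogonal complement. -/
structure LorentzianMetric {E : Type*} [NormedAddCommGroup E] [NormedSpace ℝ E]
    {H : Type*} [TopologicalSpace H] (I : ModelWithCorners ℝ E H)
    (M : Type*) [TopologicalSpace M] [ChartedSpace H M] [IsManifold I ∞ M] where
  /-- The scalar product on the tangent spaces. -/
  inner (x : M) : TangentSpace I x →L[ℝ] TangentSpace I x →L[ℝ] ℝ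
  symm (x : M) (v w : TangentSpace I x) : inner x v w = inner x w v
  signature (x : M) : ∃ t : TangentSpace I x, inner x t t < 0 ∧
    ∀ v, v ≠ 0 → inner x t v = 0 → 0 < inner x v v
  contMDiff : ContMDiff I (I.prod 𝓘(ℝ, E →L[ℝ] E →L[ℝ] ℝ)) ∞
    (fun x ↦ TotalSpace.mk' (E →L[ℝ] E →L[ℝ] ℝ)
      (E := fun x ↦ TangentSpace I x →L[ℝ] TangentSpace I x →L[ℝ] ℝ) x (inner x))

namespace LorentzianMetric

variable {E : Type*} [NormedAddCommGroup E] [NormedSpace ℝ E]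
  {H : Type*} [TopologicalSpace H] {I : ModelWithCorners ℝ E H}
  {M : Type*} [TopologicalSpace M] [ChartedSpace H M] [IsManifold I ∞ M]
  (g : LorentzianMetric I M)

theorem eq_zero_of_inner_eq_zero {x : M} {v : TangentSpace I x}
    (h : ∀ w, g.inner x v w = 0) : v = 0 := by
  obtain ⟨t, -, ht⟩ := g.signature x
  by_contra hv
  have := ht v hv (by rw [g.symm, h])
  rw [h] at this
  exact lt_irrefl _ this

theorem mdifferentiableAt_inner {X Y : Π x : M, TangentSpace I x} {x : M}
    (hX : MDiffAt (T% X) x) (hY : MDiffAt (T% Y) x) :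
    MDiffAt (fun y ↦ g.inner y (X y) (Y y)) x := by
  have : MDifferentiableAt I (I.prod 𝓘(ℝ))
      (fun m ↦ TotalSpace.mk' ℝ (E := Bundle.Trivial M ℝ) m (g.inner m (X m) (Y m))) x := by
    apply MDifferentiableAt.clm_bundle_apply₂ (F₁ := E)
      (F₂ := E)
    · exact g.contMDiff.mdifferentiableAt (by simp)
    · exact hX
    · exact hY
  simp only [mdifferentiableAt_totalSpace] at this
  exact this.2

variable {X X' Y Y' Z Z' : Π x : M, TangentSpace I x} {x : M} {f : M → ℝ}

theorem d_inner_smul_left (hf : MDiffAt f x) (hX : MDiffAt (T% X) x) (hY : MDiffAt (T% Y) x)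
    (v : TangentSpace I x) :
    d% (fun y ↦ g.inner y ((f • X) y) (Y y)) x v
      = f x * d% (fun y ↦ g.inner y (X y) (Y y)) x v + d% f x v * g.inner x (X x) (Y x) := by
  have : (fun y ↦ g.inner y ((f • X) y) (Y y)) = fun y ↦ f y * g.inner y (X y) (Y y) := by
    ext y; simp
  rw [this, mvfderiv_fun_mul hf (g.mdifferentiableAt_inner hX hY)]
  simp; ring

theorem d_inner_smul_right (hf : MDiffAt f x) (hX : MDiffAt (T% X) x) (hY : MDiffAt (T% Y) x)
    (v : TangentSpace I x) :
    d% (fun y ↦ g.inner y (X y) ((f • Y) y)) x v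
      = f x * d% (fun y ↦ g.inner y (X y) (Y y)) x v + d% f x v * g.inner x (X x) (Y x) := by
  have : (fun y ↦ g.inner y (X y) ((f • Y) y)) = fun y ↦ f y * g.inner y (X y) (Y y) := by
    ext y; simp
  rw [this, mvfderiv_fun_mul hf (g.mdifferentiableAt_inner hX hY)]
  simp; ring

theorem d_inner_add_left (hX : MDiffAt (T% X) x) (hX' : MDiffAt (T% X') x)
    (hY : MDiffAt (T% Y) x) (v : TangentSpace I x) :
    d% (fun y ↦ g.inner y ((X + X') y) (Y y)) x v
      = d% (fun y ↦ g.inner y (X y) (Y y)) x v + d% (fun y ↦ g.inner y (X' y) (Y y)) x v := by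
  have : (fun y ↦ g.inner y ((X + X') y) (Y y))
      = fun y ↦ g.inner y (X y) (Y y) + g.inner y (X' y) (Y y) := by
    ext y; simp
  rw [this, mvfderiv_fun_add (g.mdifferentiableAt_inner hX hY) (g.mdifferentiableAt_inner hX' hY)]
  simp

theorem d_inner_add_right (hX : MDiffAt (T% X) x) (hY : MDiffAt (T% Y) x)
    (hY' : MDiffAt (T% Y') x) (v : TangentSpace I x) :
    d% (fun y ↦ g.inner y (X y) ((Y + Y') y)) x v
      = d% (fun y ↦ g.inner y (X y) (Y y)) x v + d% (fun y ↦ g.inner y (X y) (Y' y)) x v := by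
  have : (fun y ↦ g.inner y (X y) ((Y + Y') y))
      = fun y ↦ g.inner y (X y) (Y y) + g.inner y (X y) (Y' y) := by
    ext y; simp
  rw [this, mvfderiv_fun_add (g.mdifferentiableAt_inner hX hY) (g.mdifferentiableAt_inner hX hY')]
  simp

variable [FiniteDimensional ℝ E]

instance finiteDimensional_tangentSpace (x : M) : FiniteDimensional ℝ (TangentSpace I x) :=
  inferInstanceAs (FiniteDimensional ℝ (E))

instance t2Space_tangentSpace (x : M) : T2Space (TangentSpace I x) :=
  inferInstanceAs (T2Space E)

theorem flat_bijective (x : M) : Function.Bijective (g.inner x) := by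
  have hinj : Function.Injective (g.inner x) := by
    rw [injective_iff_map_eq_zero]
    intro v hv
    exact g.eq_zero_of_inner_eq_zero fun w ↦ by simp [hv]
  refine ⟨hinj, ?_⟩
  let L : TangentSpace I x →ₗ[ℝ] (TangentSpace I x →ₗ[ℝ] ℝ) :=
    (LinearMap.toContinuousLinearMap (𝕜 := ℝ) (E := TangentSpace I x) (F' := ℝ)).symm.toLinearMap
      ∘ₗ (g.inner x).toLinearMap
  have hL : Function.Injective L := by
    intro a b hab
    apply hinj
    exact (LinearMap.toContinuousLinearMap (𝕜 := ℝ) (E := TangentSpace I x) (F' := ℝ)).symm.injective hab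
  have hS := (LinearMap.injective_iff_surjective_of_finrank_eq_finrank
    (Subspace.dual_finrank_eq (K := ℝ) (V := TangentSpace I x)).symm).1 hL
  intro f
  obtain ⟨v, hv⟩ := hS f.toLinearMap
  refine ⟨v, ?_⟩
  ext w
  exact congr($hv w)

/-- The musical isomorphism `♯`, inverse of `v ↦ g(v, ·)`. -/
def sharp (x : M) : (TangentSpace I x →L[ℝ] ℝ) →L[ℝ] TangentSpace I x :=
  LinearMap.toContinuousLinearMap
    (LinearEquiv.ofBijective (g.inner x).toLinearMap (g.flat_bijective x)).symm.toLinearMap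

theorem inner_sharp (x : M) (a : TangentSpace I x →L[ℝ] ℝ) :
    g.inner x (g.sharp x a) = a :=
  (LinearEquiv.ofBijective (g.inner x).toLinearMap (g.flat_bijective x)).apply_symm_apply a

/-- The right-hand side of the Koszul formula for `2 g(∇_X Y, Z)`. -/
def koszul (X Y Z : Π x : M, TangentSpace I x) (x : M) : ℝ :=
  d% (fun y ↦ g.inner y (Y y) (Z y)) x (X x)
    + d% (fun y ↦ g.inner y (X y) (Z y)) x (Y x)
    - d% (fun y ↦ g.inner y (X y) (Y y)) x (Z x)
    + g.inner x (mlieBracket I X Y x) (Z x)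
    - g.inner x (mlieBracket I X Z x) (Y x)
    - g.inner x (mlieBracket I Y Z x) (X x)

variable [CompleteSpace E]

theorem koszul_smul_left (hf : MDiffAt f x) (hX : MDiffAt (T% X) x) (hY : MDiffAt (T% Y) x)
    (hZ : MDiffAt (T% Z) x) : g.koszul (f • X) Y Z x = f x * g.koszul X Y Z x := by
  simp only [koszul, g.d_inner_smul_left hf hX hZ, g.d_inner_smul_left hf hX hY,
    mlieBracket_smul_left hf hX]
  simp
  ring

theorem koszul_smul_middle (hf : MDiffAt f x) (hX : MDiffAt (T% X) x) (hY : MDiffAt (T% Y) x)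
    (hZ : MDiffAt (T% Z) x) : g.koszul X (f • Y) Z x
      = f x * g.koszul X Y Z x + 2 * (d% f x (X x) * g.inner x (Y x) (Z x)) := by
  simp only [koszul, g.d_inner_smul_left hf hY hZ, g.d_inner_smul_right hf hX hY,
    mlieBracket_smul_left hf hY, mlieBracket_smul_right hf hY]
  simp [g.symm x (Y x) (Z x), g.symm x (Y x) (X x)]
  ring

theorem koszul_smul_right (hf : MDiffAt f x) (hX : MDiffAt (T% X) x) (hY : MDiffAt (T% Y) x)
    (hZ : MDiffAt (T% Z) x) : g.koszul X Y (f • Z) x = f x * g.koszul X Y Z x := by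
  simp only [koszul, g.d_inner_smul_right hf hX hZ, g.d_inner_smul_right hf hY hZ,
    mlieBracket_smul_right hf hZ]
  simp [g.symm x (Y x) (Z x), g.symm x (Z x) (X x)]
  ring

theorem koszul_add_left (hX : MDiffAt (T% X) x) (hX' : MDiffAt (T% X') x) (hY : MDiffAt (T% Y) x)
    (hZ : MDiffAt (T% Z) x) :
    g.koszul (X + X') Y Z x = g.koszul X Y Z x + g.koszul X' Y Z x := by
  simp only [koszul, g.d_inner_add_left hX hX' hZ, g.d_inner_add_left hX hX' hY,
    mlieBracket_add_left hX hX']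
  simp
  ring

theorem koszul_add_middle (hX : MDiffAt (T% X) x) (hY : MDiffAt (T% Y) x)
    (hY' : MDiffAt (T% Y') x) (hZ : MDiffAt (T% Z) x) :
    g.koszul X (Y + Y') Z x = g.koszul X Y Z x + g.koszul X Y' Z x := by
  simp only [koszul, g.d_inner_add_left hY hY' hZ, g.d_inner_add_right hX hY hY',
    mlieBracket_add_left hY hY', mlieBracket_add_right hY hY']
  simp
  ring

theorem koszul_add_right (hX : MDiffAt (T% X) x) (hY : MDiffAt (T% Y) x) (hZ : MDiffAt (T% Z) x)
    (hZ' : MDiffAt (T% Z') x) :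
    g.koszul X Y (Z + Z') x = g.koszul X Y Z x + g.koszul X Y Z' x := by
  simp only [koszul, g.d_inner_add_right hX hZ hZ', g.d_inner_add_right hY hZ hZ',
    mlieBracket_add_right hZ hZ']
  simp
  ring

open scoped Classical in
/-- For a field `Y` differentiable at `x`, the bilinear form `(v, w) ↦ 2 g(∇_v Y, w)` on `T_x M`
given by the Koszul formula (zero if `Y` is not differentiable at `x`). -/
def koszulForm (Y : Π x : M, TangentSpace I x) (x : M) :
    TangentSpace I x →L[ℝ] TangentSpace I x →L[ℝ] ℝ :=
  if hY : MDiffAt (T% Y) x then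
    TensorialAt.mkHom₂ (I := I) (F := E)
      (F' := E) (fun X Z ↦ g.koszul X Y Z x) x
      (fun _ hZ ↦ ⟨fun hf hX ↦ g.koszul_smul_left hf hX hY hZ,
        fun hX hX' ↦ g.koszul_add_left hX hX' hY hZ⟩)
      (fun _ hX ↦ ⟨fun hf hZ ↦ g.koszul_smul_right hf hX hY hZ,
        fun hZ hZ' ↦ g.koszul_add_right hX hY hZ hZ'⟩)
  else 0

theorem koszulForm_apply (hX : MDiffAt (T% X) x) (hY : MDiffAt (T% Y) x)
    (hZ : MDiffAt (T% Z) x) : g.koszulForm Y x (X x) (Z x) = g.koszul X Y Z x := by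
  rw [koszulForm, dif_pos hY]
  exact TensorialAt.mkHom₂_apply _ _ hX hZ

/-- The Levi-Civita connection: `g(∇_X Y, Z)` is half of the Koszul expression.
As for every `CovariantDerivative`, `∇_v Y` is written `g.leviCivita Y x v` for `v ∈ T_x M`. -/
def leviCivita : CovariantDerivative I E
    (TangentSpace I : M → Type _) where
  toFun Y x := (1 / 2 : ℝ) • (g.sharp x ∘L g.koszulForm Y x)
  isCovariantDerivativeOnUniv := by
    have key : ∀ {x : M} {a b : TangentSpace I x}, (∀ w, g.inner x a w = g.inner x b w) →
        a = b := fun {x a b} h ↦ by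
      rw [← sub_eq_zero]
      exact g.eq_zero_of_inner_eq_zero fun w ↦ by simp [h]
    constructor
    · intro Y Y' x hY hY' _
      ext1 v
      refine key fun w ↦ ?_
      have hv := mdifferentiableAt_extend I E v
      have hw := mdifferentiableAt_extend I E w
      have e1 := g.koszulForm_apply hv hY hw
      have e2 := g.koszulForm_apply hv hY' hw
      have e3 := g.koszulForm_apply hv (mdifferentiableAt_add_section hY hY') hw
      rw [g.koszul_add_middle hv hY hY' hw] at e3
      simp only [extend_apply_self] at e1 e2 e3
      simp [inner_sharp, e1, e2, e3]
      ring
    · intro Y f x hY hf _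
      ext1 v
      refine key fun w ↦ ?_
      have hv := mdifferentiableAt_extend I E v
      have hw := mdifferentiableAt_extend I E w
      have e1 := g.koszulForm_apply hv hY hw
      have e3 := g.koszulForm_apply hv (hf.smul_section hY) hw
      rw [g.koszul_smul_middle hf hv hY hw] at e3
      simp only [extend_apply_self] at e1 e3
      simp [inner_sharp, e1, e3]
      ring

theorem inner_leviCivita (hX : MDiffAt (T% X) x) (hY : MDiffAt (T% Y) x)
    (hZ : MDiffAt (T% Z) x) :
    2 * g.inner x (g.leviCivita Y x (X x)) (Z x) = g.koszul X Y Z x := by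
  rw [← g.koszulForm_apply hX hY hZ]
  simp [leviCivita, inner_sharp]

/-- The Levi-Civita connection is torsion-free. -/
theorem leviCivita_torsion (hX : MDiffAt (T% X) x) (hY : MDiffAt (T% Y) x) :
    g.leviCivita Y x (X x) - g.leviCivita X x (Y x) = mlieBracket I X Y x := by
  rw [← sub_eq_zero]
  refine g.eq_zero_of_inner_eq_zero fun w ↦ ?_
  have hw := mdifferentiableAt_extend I E w
  have e1 := g.inner_leviCivita hX hY hw
  have e2 := g.inner_leviCivita hY hX hw
  have e3 : mlieBracket I Y X x = - mlieBracket I X Y x := mlieBracket_swap_apply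
  have e4 : (fun y ↦ g.inner y (Y y) (X y)) = fun y ↦ g.inner y (X y) (Y y) := by
    ext y; exact g.symm y _ _
  simp only [koszul, extend_apply_self, e3, e4] at e1 e2
  simp at e1 e2 ⊢
  linarith

/-- The Levi-Civita connection is metric. -/
theorem leviCivita_metric (hX : MDiffAt (T% X) x) (hY : MDiffAt (T% Y) x)
    (v : TangentSpace I x) :
    d% (fun y ↦ g.inner y (X y) (Y y)) x v
      = g.inner x (g.leviCivita X x v) (Y x) + g.inner x (X x) (g.leviCivita Y x v) := by
  have hv := mdifferentiableAt_extend I E v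
  have e1 := g.inner_leviCivita hv hX hY
  have e2 := g.inner_leviCivita hv hY hX
  have e3 : mlieBracket I Y X x = - mlieBracket I X Y x := mlieBracket_swap_apply
  have e4 : (fun y ↦ g.inner y (Y y) (X y)) = fun y ↦ g.inner y (X y) (Y y) := by
    ext y; exact g.symm y _ _
  simp only [koszul, extend_apply_self, e3, e4] at e1 e2
  rw [g.symm x (X x)]
  simp at e1 e2 ⊢
  linarith

/-- The Riemann curvature tensor `R(u, v)w = ∇_U ∇_V W - ∇_V ∇_U W - ∇_[U, V] W`, where `U, V, W`
are local extensions of `u, v, w ∈ T_x M` to vector fields smooth near `x`; being tensorial, the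
value does not depend on the extensions. -/
def curvature (x : M) (u v w : TangentSpace I x) : TangentSpace I x :=
  let U : Π y : M, TangentSpace I y := extend E u
  let V : Π y : M, TangentSpace I y := extend E v
  let W : Π y : M, TangentSpace I y := extend E w
  g.leviCivita (fun y ↦ g.leviCivita W y (V y)) x u
    - g.leviCivita (fun y ↦ g.leviCivita W y (U y)) x v
    - g.leviCivita W x (mlieBracket I U V x)

/-- The Ricci tensor `S(v, w)`, the trace of `u ↦ R(u, v)w`. -/
def ricci (x : M) (v w : TangentSpace I x) : ℝ :=
  ∑ i, (Module.finBasis ℝ (TangentSpace I x)).coord i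
    (g.curvature x (Module.finBasis ℝ (TangentSpace I x) i) v w)

/-- The scalar curvature `r`, the metric trace `∑ᵢ S(eᵢ, (eⁱ)^♯) = ∑ᵢⱼ gⁱʲ S(eᵢ, eⱼ)` of the Ricci
tensor, where `(eⁱ)` is the basis dual to the basis `(eᵢ)` of `T_x M`. -/
def scalarCurvature (x : M) : ℝ :=
  ∑ i, g.ricci x (Module.finBasis ℝ (TangentSpace I x) i)
    (g.sharp x (LinearMap.toContinuousLinearMap ((Module.finBasis ℝ (TangentSpace I x)).coord i)))

/-- The gradient `Dv`, characterized by `g(Dv, w) = dv(w)`. -/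
def gradient (v : M → ℝ) (x : M) : TangentSpace I x := g.sharp x (d% v x)

/-- The Hessian `(∇²v)(a, b) = g(∇_a Dv, b)`. -/
def hessian (v : M → ℝ) (x : M) (a b : TangentSpace I x) : ℝ :=
  g.inner x (g.leviCivita (g.gradient v) x a) b

/-- The metric is Einstein: its Ricci tensor is a nonzero constant multiple of it. -/
def IsEinstein : Prop :=
  ∃ c : ℝ, c ≠ 0 ∧ ∀ (x : M) (a b : TangentSpace I x), g.ricci x a b = c * g.inner x a b

/-- The metric is a gradient Ricci-Yamabe soliton with smooth potential `v`:
`∇²v + σ S + (Λ - ρ r / 2) g = 0`. -/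
structure IsGradientRicciYamabeSoliton (v : M → ℝ) (σ ρ Λ : ℝ) : Prop where
  contMDiff : ContMDiff I 𝓘(ℝ) ∞ v
  equation (x : M) (a b : TangentSpace I x) :
    g.hessian v x a b + σ * g.ricci x a b
      + (Λ - ρ * g.scalarCurvature x / 2) * g.inner x a b = 0

/-- A gradient Ricci soliton is a gradient Ricci-Yamabe soliton with `σ = 1` and `ρ = 0`. -/
def IsGradientRicciSoliton (v : M → ℝ) (Λ : ℝ) : Prop :=
  g.IsGradientRicciYamabeSoliton v 1 0 Λ

/-- A gradient Einstein soliton is a gradient Ricci-Yamabe soliton with `σ = 1` and `ρ = -1`. -/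
def IsGradientEinsteinSoliton (v : M → ℝ) (Λ : ℝ) : Prop :=
  g.IsGradientRicciYamabeSoliton v 1 (-1) Λ

end LorentzianMetric

section LPKenmotsu

variable {E : Type*} [NormedAddCommGroup E] [NormedSpace ℝ E]
  {H : Type*} [TopologicalSpace H] {I : ModelWithCorners ℝ E H}
  {M : Type*} [TopologicalSpace M] [ChartedSpace H M] [IsManifold I ∞ M]

/-- A Lorentzian almost paracontact metric structure `(φ, ζ, ν, g)` on `M`: a smooth `(1, 1)`-tensor
field `φ`, a smooth vector field `ζ` and a 1-form `ν` (smooth because `ν = g(·, ζ)`). -/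
structure LorentzianAlmostParacontact (g : LorentzianMetric I M) where
  /-- The `(1, 1)`-tensor field. -/
  φ (x : M) : TangentSpace I x →L[ℝ] TangentSpace I x
  /-- The characteristic vector field. -/
  ζ (x : M) : TangentSpace I x
  /-- The 1-form. -/
  ν (x : M) : TangentSpace I x →L[ℝ] ℝ
  contMDiff_φ : ContMDiff I (I.prod 𝓘(ℝ, E →L[ℝ] E)) ∞
    (fun x ↦ TotalSpace.mk' (E →L[ℝ] E) (E := fun x ↦ TangentSpace I x →L[ℝ] TangentSpace I x)
      x (φ x))
  contMDiff_ζ : ContMDiff I I.tangent ∞ (fun x ↦ (⟨x, ζ x⟩ : TangentBundle I M))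
  ν_ζ (x : M) : ν x (ζ x) + 1 = 0
  φ_φ (x : M) (a : TangentSpace I x) : φ x (φ x a) = a + ν x a • ζ x
  φ_ζ (x : M) : φ x (ζ x) = 0
  ν_φ (x : M) (a : TangentSpace I x) : ν x (φ x a) = 0
  inner_φ_φ (x : M) (a b : TangentSpace I x) :
    g.inner x (φ x a) (φ x b) = g.inner x a b + ν x a * ν x b
  inner_ζ (x : M) (a : TangentSpace I x) : g.inner x a (ζ x) = ν x a
  φ_symm (x : M) (a b : TangentSpace I x) : g.inner x (φ x a) b = g.inner x a (φ x b)

/-- The structure is Lorentzian para-Kenmotsu: `(∇_a φ)Y = -g(φ a, Y)ζ - ν(Y)φ a`, where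
`(∇_a φ)Y = ∇_a (φ Y) - φ (∇_a Y)`, for every vector field `Y` and every tangent vector `a`. -/
def LorentzianAlmostParacontact.IsLPKenmotsu [FiniteDimensional ℝ E] [CompleteSpace E]
    {g : LorentzianMetric I M} (P : LorentzianAlmostParacontact g) : Prop :=
  ∀ (Y : Π x : M, TangentSpace I x) (x : M), MDiffAt (T% Y) x → ∀ a : TangentSpace I x,
    g.leviCivita (fun y ↦ P.φ y (Y y)) x a - P.φ x (g.leviCivita Y x a)
      = -g.inner x (P.φ x a) (Y x) • P.ζ x - P.ν x (Y x) • P.φ x a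

end LPKenmotsu

end

noncomputable section

section Smooth

variable {E : Type*} [NormedAddCommGroup E] [NormedSpace ℝ E]
  {H : Type*} [TopologicalSpace H] {I : ModelWithCorners ℝ E H}
  {M : Type*} [TopologicalSpace M] [ChartedSpace H M]

variable (I) in
/-- A real function which is smooth in a neighbourhood of `x`. -/
def SmoothFunNear (f : M → ℝ) (x : M) : Prop :=
  ∀ᶠ y in 𝓝 x, ContMDiffAt I 𝓘(ℝ) ∞ f y

variable {X Y Z : Π x : M, TangentSpace I x} {x : M} {f f' : M → ℝ}

namespace SmoothFunNear

theorem contMDiffAt (h : SmoothFunNear I f x) : ContMDiffAt I 𝓘(ℝ) ∞ f x := h.self_of_nhds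

theorem mdifferentiableAt (h : SmoothFunNear I f x) : MDiffAt f x :=
  h.contMDiffAt.mdifferentiableAt (by simp)

theorem eventually (h : SmoothFunNear I f x) : ∀ᶠ y in 𝓝 x, SmoothFunNear I f y :=
  h.eventually_nhds

theorem congr (h : SmoothFunNear I f x) (hf : ∀ᶠ y in 𝓝 x, f' y = f y) :
    SmoothFunNear I f' x := by
  filter_upwards [h, hf.eventually_nhds] with y hy hy'
  exact hy.congr_of_eventuallyEq hy'

theorem const (c : ℝ) : SmoothFunNear I (fun _ : M ↦ c) x :=
  Filter.Eventually.of_forall fun _ ↦ contMDiffAt_const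

theorem add (h : SmoothFunNear I f x) (h' : SmoothFunNear I f' x) :
    SmoothFunNear I (fun y ↦ f y + f' y) x := by
  filter_upwards [h, h'] with y hy hy' using hy.add hy'

theorem neg (h : SmoothFunNear I f x) : SmoothFunNear I (fun y ↦ -f y) x := by
  filter_upwards [h] with y hy using hy.neg

theorem sub (h : SmoothFunNear I f x) (h' : SmoothFunNear I f' x) :
    SmoothFunNear I (fun y ↦ f y - f' y) x := by
  filter_upwards [h, h'] with y hy hy' using hy.sub hy'

theorem mul (h : SmoothFunNear I f x) (h' : SmoothFunNear I f' x) :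
    SmoothFunNear I (fun y ↦ f y * f' y) x := by
  filter_upwards [h, h'] with y hy hy'
  have := hy.smul hy'
  exact this

theorem sum {ι : Type*} {s : Finset ι} {F : ι → M → ℝ} (h : ∀ i ∈ s, SmoothFunNear I (F i) x) :
    SmoothFunNear I (fun y ↦ ∑ i ∈ s, F i y) x := by
  classical
  induction s using Finset.induction_on with
  | empty => simpa using const (x := x) (I := I) 0
  | insert a s ha ih =>
    simp only [Finset.sum_insert ha]
    exact (h a (by simp)).add (ih fun i hi ↦ h i (by simp [hi]))

theorem prod {ι : Type*} {s : Finset ι} {F : ι → M → ℝ} (h : ∀ i ∈ s, SmoothFunNear I (F i) x) :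
    SmoothFunNear I (fun y ↦ ∏ i ∈ s, F i y) x := by
  classical
  induction s using Finset.induction_on with
  | empty => simpa using const (x := x) (I := I) 1
  | insert a s ha ih =>
    simp only [Finset.prod_insert ha]
    exact (h a (by simp)).mul (ih fun i hi ↦ h i (by simp [hi]))

theorem det {ι : Type*} [Fintype ι] [DecidableEq ι] {A : M → Matrix ι ι ℝ}
    (h : ∀ i j, SmoothFunNear I (fun y ↦ A y i j) x) :
    SmoothFunNear I (fun y ↦ (A y).det) x := by
  simp only [Matrix.det_apply']
  exact sum fun σ _ ↦ (const _).mul (prod fun i _ ↦ h _ _)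

theorem inv (h : SmoothFunNear I f x) (hf : f x ≠ 0) : SmoothFunNear I (fun y ↦ (f y)⁻¹) x := by
  filter_upwards [h, h.contMDiffAt.continuousAt.eventually_ne hf] with y hy hy'
  exact hy.inv₀ hy'

end SmoothFunNear

variable [IsManifold I ∞ M]

variable (I) in
/-- A vector field which is smooth in a neighbourhood of `x`. -/
def SmoothNear (X : Π x : M, TangentSpace I x) (x : M) : Prop :=
  ∀ᶠ y in 𝓝 x, ContMDiffAt I I.tangent ∞ (fun z ↦ (⟨z, X z⟩ : TangentBundle I M)) y

namespace SmoothNear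

theorem contMDiffAt (h : SmoothNear I X x) :
    ContMDiffAt I I.tangent ∞ (fun z ↦ (⟨z, X z⟩ : TangentBundle I M)) x := h.self_of_nhds

theorem eventually (h : SmoothNear I X x) : ∀ᶠ y in 𝓝 x, SmoothNear I X y :=
  h.eventually_nhds

theorem congr (h : SmoothNear I X x) (hf : ∀ᶠ y in 𝓝 x, Y y = X y) : SmoothNear I Y x := by
  filter_upwards [h, hf.eventually_nhds] with y hy hy'
  exact hy.congr_of_eventuallyEq (hy'.mono fun z hz ↦ by simp [hz])

theorem mdifferentiableAt (h : SmoothNear I X x) : MDiffAt (T% X) x :=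
  h.contMDiffAt.mdifferentiableAt (by simp)

theorem add (h : SmoothNear I X x) (h' : SmoothNear I Y x) : SmoothNear I (X + Y) x := by
  filter_upwards [h, h'] with y hy hy' using hy.add_section hy'

theorem neg (h : SmoothNear I X x) : SmoothNear I (-X) x := by
  filter_upwards [h] with y hy using hy.neg_section

theorem sub (h : SmoothNear I X x) (h' : SmoothNear I Y x) : SmoothNear I (X - Y) x := by
  filter_upwards [h, h'] with y hy hy' using hy.sub_section hy'

theorem smul (hf : SmoothFunNear I f x) (h : SmoothNear I X x) : SmoothNear I (f • X) x := by
  filter_upwards [hf, h] with y hy hy' using hy.smul_section hy'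

theorem zero : SmoothNear I (0 : Π x : M, TangentSpace I x) x :=
  Filter.Eventually.of_forall fun _ ↦ contMDiff_zeroSection ℝ (TangentSpace I : M → Type _) _

theorem sum {ι : Type*} {s : Finset ι} {F : ι → Π x : M, TangentSpace I x}
    (h : ∀ i ∈ s, SmoothNear I (F i) x) : SmoothNear I (fun y ↦ ∑ i ∈ s, F i y) x := by
  classical
  induction s using Finset.induction_on with
  | empty => simpa using! zero (x := x) (I := I)
  | insert a s ha ih =>
    simp only [Finset.sum_insert ha]
    exact (h a (by simp)).add (ih fun i hi ↦ h i (by simp [hi]))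

theorem extend (v : TangentSpace I x) : SmoothNear I (extend E v) x := by
  obtain ⟨s, hs, h⟩ := exists_contMDiffOn_extend (k := ∞) I E v
  filter_upwards [eventually_mem_nhds_iff.2 hs] with y hy
  exact h.contMDiffAt hy

theorem _root_.minSmoothness_le_infty (k : ℕ) : minSmoothness ℝ (k : ℕ∞ω) ≤ ∞ := by
  simp only [minSmoothness_of_isRCLikeNormedField]
  exact WithTop.coe_le_coe.2 (le_top (a := (k : ℕ∞)))

theorem mlieBracket [CompleteSpace E] (h : SmoothNear I X x) (h' : SmoothNear I Y x) :
    SmoothNear I (mlieBracket I X Y) x := by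
  have : IsManifold I (((⊤ : ℕ∞) : ℕ∞ω) + 1) M := inferInstanceAs (IsManifold I ∞ M)
  have : IsManifold I (minSmoothness ℝ 2) M := .of_le (n := ∞) (minSmoothness_le_infty 2)
  filter_upwards [h, h'] with y hy hy'
  exact ContMDiffAt.mlieBracket_vectorField (n := ⊤) (m := ⊤) hy hy'
    (by simp [minSmoothness_of_isRCLikeNormedField])

theorem jacobi [CompleteSpace E] (hX : SmoothNear I X x) (hY : SmoothNear I Y x)
    (hZ : SmoothNear I Z x) :
    VectorField.mlieBracket I X (VectorField.mlieBracket I Y Z) x =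
      VectorField.mlieBracket I (VectorField.mlieBracket I X Y) Z x
        + VectorField.mlieBracket I Y (VectorField.mlieBracket I X Z) x := by
  have : IsManifold I (minSmoothness ℝ 3) M := .of_le (n := ∞) (minSmoothness_le_infty 3)
  exact leibniz_identity_mlieBracket_apply (hX.contMDiffAt.of_le (minSmoothness_le_infty 2))
    (hY.contMDiffAt.of_le (minSmoothness_le_infty 2))
    (hZ.contMDiffAt.of_le (minSmoothness_le_infty 2))

end SmoothNear

/-- A smooth frame of the tangent bundle near `x`, with its coefficient functionals. -/
theorem exists_smooth_frame [FiniteDimensional ℝ E] (x : M) :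
    ∃ (e : Fin (Module.finrank ℝ E) → Π y : M, TangentSpace I y)
      (c : Fin (Module.finrank ℝ E) → Π y : M, TangentSpace I y →ₗ[ℝ] ℝ),
      (∀ i, SmoothNear I (e i) x) ∧
      (∀ i X, SmoothNear I X x → SmoothFunNear I (fun y ↦ c i y (X y)) x) ∧
      (∀ᶠ y in 𝓝 x, ∃ b : Module.Basis (Fin (Module.finrank ℝ E)) ℝ (TangentSpace I y),
        ∀ i, e i y = b i ∧ c i y = b.coord i) := by
  let t := trivializationAt E (TangentSpace I : M → Type _) x
  have hx : x ∈ t.baseSet := FiberBundle.mem_baseSet_trivializationAt' x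
  have ht := t.open_baseSet.mem_nhds hx
  let b := Module.finBasis ℝ E
  refine ⟨t.localFrame b, t.localFrameCoeff I b, fun i ↦ ?_, fun i X hX ↦ ?_, ?_⟩
  · filter_upwards [ht] with y hy
    exact contMDiffAt_localFrame_of_mem (I := I) ∞ t b i hy
  · filter_upwards [ht, hX] with y hy hXy
    exact contMDiffAt_localFrameCoeff b hy hXy i
  · filter_upwards [ht] with y hy
    refine ⟨t.basisAt b hy, fun i ↦ ⟨by simp [hy], ?_⟩⟩
    ext v
    have := t.localFrameCoeff_apply_of_mem_baseSet (I := I) b hy (fun z ↦ t.symm z (t ⟨y, v⟩).2) i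
    have h2 : t.symm y (t ⟨y, v⟩).2 = v := by simp [hy]
    simpa [h2] using this

end Smooth

section Derivations

variable {E : Type*} [NormedAddCommGroup E] [NormedSpace ℝ E] [FiniteDimensional ℝ E]
  {H : Type*} [TopologicalSpace H] {I : ModelWithCorners ℝ E H}
  {M : Type*} [TopologicalSpace M] [ChartedSpace H M] [IsManifold I ∞ M]
  {X Y Z U V W : Π x : M, TangentSpace I x} {x : M} {f f' : M → ℝ}

/-- An operation on germs of smooth vector fields which is additive and linear over smooth functions
depends only on the value of the field at the point. -/
theorem SmoothNear.tensorial {A : Type*} [AddCommGroup A] [Module ℝ A]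
    {Φ : (Π x : M, TangentSpace I x) → A}
    (hadd : ∀ {X Y}, SmoothNear I X x → SmoothNear I Y x → Φ (X + Y) = Φ X + Φ Y)
    (hsmul : ∀ {f : M → ℝ} {X}, SmoothFunNear I f x → SmoothNear I X x → Φ (f • X) = f x • Φ X)
    (hX : SmoothNear I X x) (hY : SmoothNear I Y x) (hXY : X x = Y x) : Φ X = Φ Y := by
  classical
  have hzero : Φ 0 = 0 := by
    have := hsmul (SmoothFunNear.const 0) (SmoothNear.zero (I := I) (x := x))
    simpa using this
  have hloc {X Y : Π x : M, TangentSpace I x} (hX : SmoothNear I X x) (hY : SmoothNear I Y x)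
      (h : ∀ᶠ y in 𝓝 x, X y = Y y) : Φ X = Φ Y := by
    let ψ (y : M) : ℝ := if X y = Y y then 1 else 0
    have hψx : ψ x = 1 := by simp [ψ, h.self_of_nhds]
    have hψ : SmoothFunNear I ψ x :=
      (SmoothFunNear.const 1).congr (h.mono fun y hy ↦ by simp [ψ, hy])
    have e : ψ • X = ψ • Y := by
      ext y : 1
      by_cases hy : X y = Y y <;> simp [ψ, hy]
    have e1 := hsmul hψ hX
    have e2 := hsmul hψ hY
    rw [hψx, one_smul] at e1 e2
    rw [← e1, ← e2, e]
  have hsum {ι : Type _} (s : Finset ι) (F : ι → Π x : M, TangentSpace I x)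
      (h : ∀ i ∈ s, SmoothNear I (F i) x) :
      Φ (fun y ↦ ∑ i ∈ s, F i y) = ∑ i ∈ s, Φ (F i) := by
    induction s using Finset.induction_on with
    | empty => simpa using! hzero
    | insert a s ha ih =>
      simp only [Finset.sum_insert ha]
      rw [← ih fun i hi ↦ h i (by simp [hi])]
      exact hadd (h a (by simp)) (SmoothNear.sum fun i hi ↦ h i (by simp [hi]))
  obtain ⟨e, c, he, hc, hb⟩ := exists_smooth_frame (I := I) x
  have key {X : Π x : M, TangentSpace I x} (hX : SmoothNear I X x) :
      Φ X = ∑ i, c i x (X x) • Φ (e i) := by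
    have h1 : ∀ i ∈ Finset.univ, SmoothNear I ((fun y ↦ c i y (X y)) • e i) x :=
      fun i _ ↦ SmoothNear.smul (hc i X hX) (he i)
    rw [hloc hX (SmoothNear.sum h1), hsum _ _ h1]
    · exact Finset.sum_congr rfl fun i _ ↦ hsmul (hc i X hX) (he i)
    · filter_upwards [hb] with y ⟨b, hb⟩
      conv_lhs => rw [← b.sum_repr (X y)]
      simp [hb]
  rw [key hX, key hY, hXY]

/-- The derivative of a smooth function along a smooth vector field is smooth. -/
theorem SmoothFunNear.d [Nontrivial E] (hf : SmoothFunNear I f x) (hX : SmoothNear I X x) :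
    SmoothFunNear I (fun y ↦ d% f y (X y)) x := by
  obtain ⟨e, c, he, hc, hb⟩ := exists_smooth_frame (I := I) x
  let i : Fin (Module.finrank ℝ E) := ⟨0, Module.finrank_pos⟩
  have h1 := (hX.mlieBracket (SmoothNear.smul hf (he i))).sub
    (SmoothNear.smul hf (hX.mlieBracket (he i)))
  refine (hc i _ h1).congr ?_
  filter_upwards [hf.eventually, (he i).eventually, hb] with y hfy hey ⟨b, hb⟩
  simp [mlieBracket_smul_right hfy.mdifferentiableAt hey.mdifferentiableAt, hb]

/-- The Lie bracket of vector fields is the commutator of the corresponding derivations. -/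
theorem d_mlieBracket [Nontrivial E] (hf : SmoothFunNear I f x) (hX : SmoothNear I X x)
    (hY : SmoothNear I Y x) :
    d% f x (mlieBracket I X Y x)
      = d% (fun y ↦ d% f y (Y y)) x (X x) - d% (fun y ↦ d% f y (X y)) x (Y x) := by
  have : Nontrivial (TangentSpace I x) := inferInstanceAs (Nontrivial E)
  obtain ⟨w, hw⟩ := exists_ne (0 : TangentSpace I x)
  have hW := SmoothNear.extend w
  set W : Π y : M, TangentSpace I y := extend E w
  have hWx : W x = w := extend_apply_self ..
  have main {X Y : Π x : M, TangentSpace I x} (hX : SmoothNear I X x) (hY : SmoothNear I Y x) :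
      mlieBracket I X (mlieBracket I Y (f • W)) x =
        d% (fun y ↦ d% f y (Y y)) x (X x) • w + d% f x (Y x) • mlieBracket I X W x
        + d% f x (X x) • mlieBracket I Y W x + f x • mlieBracket I X (mlieBracket I Y W) x := by
    have e : ∀ᶠ y in 𝓝 x, mlieBracket I Y (f • W) y
        = ((fun y ↦ d% f y (Y y)) • W + f • mlieBracket I Y W) y := by
      filter_upwards [hf.eventually, hW.eventually] with y hfy hWy
      simp [mlieBracket_smul_right hfy.mdifferentiableAt hWy.mdifferentiableAt]
    rw [Filter.EventuallyEq.mlieBracket_vectorField_eq (Filter.EventuallyEq.refl _ X) e,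
      mlieBracket_add_right (SmoothNear.smul (hf.d hY) hW).mdifferentiableAt
        (SmoothNear.smul hf (hY.mlieBracket hW)).mdifferentiableAt,
      mlieBracket_smul_right (hf.d hY).mdifferentiableAt hW.mdifferentiableAt,
      mlieBracket_smul_right hf.mdifferentiableAt (hY.mlieBracket hW).mdifferentiableAt, hWx]
    abel
  have j1 := hX.jacobi hY (SmoothNear.smul hf hW)
  have j2 := hX.jacobi hY hW
  rw [main hX hY, main hY hX, mlieBracket_smul_right hf.mdifferentiableAt hW.mdifferentiableAt,
    j2, hWx] at j1
  have : (d% f x (mlieBracket I X Y x)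
      - (d% (fun y ↦ d% f y (Y y)) x (X x) - d% (fun y ↦ d% f y (X y)) x (Y x))) • w = 0 := by
    rw [← sub_eq_zero] at j1
    rw [sub_smul, sub_smul, ← neg_eq_zero, ← j1]
    simp only [smul_add]
    abel
  exact sub_eq_zero.1 ((smul_eq_zero.1 this).resolve_right hw)

end Derivations

namespace LorentzianMetric

variable {E : Type*} [NormedAddCommGroup E] [NormedSpace ℝ E]
  {H : Type*} [TopologicalSpace H] {I : ModelWithCorners ℝ E H}
  {M : Type*} [TopologicalSpace M] [ChartedSpace H M] [IsManifold I ∞ M]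
  (g : LorentzianMetric I M)
  {X Y Z U V W : Π x : M, TangentSpace I x} {x : M} {f f' : M → ℝ}

theorem eq_of_inner_eq {v w : TangentSpace I x} (h : ∀ u, g.inner x v u = g.inner x w u) :
    v = w := by
  rw [← sub_eq_zero]
  exact g.eq_zero_of_inner_eq_zero fun u ↦ by simp [h]

theorem smooth_inner (hX : SmoothNear I X x) (hY : SmoothNear I Y x) :
    SmoothFunNear I (fun y ↦ g.inner y (X y) (Y y)) x := by
  filter_upwards [hX, hY] with y hXy hYy
  have : ContMDiffAt I (I.prod 𝓘(ℝ)) ∞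
      (fun m ↦ TotalSpace.mk' ℝ (E := Bundle.Trivial M ℝ) m (g.inner m (X m) (Y m))) y := by
    apply ContMDiffAt.clm_bundle_apply₂ (F₁ := E) (F₂ := E)
    · exact g.contMDiff y
    · exact hXy
    · exact hYy
  simp only [contMDiffAt_totalSpace] at this
  exact this.2

variable [FiniteDimensional ℝ E]

/-- A vector field is smooth if its inner products with smooth vector fields are. -/
theorem smoothNear_of_inner
    (h : ∀ Z, SmoothNear I Z x → SmoothFunNear I (fun y ↦ g.inner y (X y) (Z y)) x) :
    SmoothNear I X x := by
  obtain ⟨e, c, he, hc, hb⟩ := exists_smooth_frame (I := I) x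
  let G (y : M) : Matrix (Fin (Module.finrank ℝ E)) (Fin (Module.finrank ℝ E)) ℝ :=
    Matrix.of fun i j ↦ g.inner y (e i y) (e j y)
  let k (y : M) (i : Fin (Module.finrank ℝ E)) : ℝ := g.inner y (X y) (e i y)
  have hG : ∀ i j, SmoothFunNear I (fun y ↦ G y i j) x := fun i j ↦ g.smooth_inner (he i) (he j)
  have hk : ∀ i, SmoothFunNear I (fun y ↦ k y i) x := fun i ↦ h _ (he i)
  have hmul : ∀ᶠ y in 𝓝 x, (G y).mulVec (fun i ↦ c i y (X y)) = k y ∧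
      X y = ∑ i, c i y (X y) • e i y := by
    filter_upwards [hb] with y ⟨b, hb⟩
    have h2 : X y = ∑ i, c i y (X y) • e i y := by
      conv_lhs => rw [← b.sum_repr (X y)]
      simp [hb]
    refine ⟨?_, h2⟩
    ext i
    simp only [Matrix.mulVec, dotProduct, G, k, Matrix.of_apply]
    conv_rhs => rw [h2]
    simp only [map_sum, map_smul, _root_.sum_apply, _root_.smul_apply, smul_eq_mul]
    exact Finset.sum_congr rfl fun j _ ↦ by rw [g.symm, mul_comm]
  have hdet : (G x).det ≠ 0 := by
    obtain ⟨b, hb⟩ := hb.self_of_nhds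
    intro h0
    obtain ⟨w, hw, hw'⟩ := Matrix.exists_mulVec_eq_zero_iff.2 h0
    apply hw
    have hz : ∑ j, w j • b j = 0 := by
      refine g.eq_zero_of_inner_eq_zero fun u ↦ ?_
      rw [← b.sum_repr u]
      simp only [map_sum, map_smul, smul_eq_mul]
      refine Finset.sum_eq_zero fun i _ ↦ mul_eq_zero_of_right _ ?_
      have := congrFun hw' i
      simp only [Matrix.mulVec, dotProduct, G, Matrix.of_apply, (hb _).1, Pi.zero_apply] at this
      rw [← this]
      simp only [_root_.sum_apply, _root_.smul_apply, smul_eq_mul]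
      exact Finset.sum_congr rfl fun j _ ↦ by rw [g.symm, mul_comm]
    ext j
    exact Fintype.linearIndependent_iff.1 b.linearIndependent w hz j
  have hdet' := SmoothFunNear.det hG
  have hcr : ∀ i, SmoothFunNear I (fun y ↦ ((G y).det)⁻¹ * ((G y).updateCol i (k y)).det) x := by
    refine fun i ↦ (hdet'.inv hdet).mul (SmoothFunNear.det fun a j ↦ ?_)
    by_cases hij : j = i
    · subst hij
      simpa using hk a
    · simpa [hij] using hG a j
  refine (SmoothNear.sum (s := Finset.univ) fun i _ ↦ SmoothNear.smul (hcr i) (he i)).congr ?_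
  filter_upwards [hmul, hdet'.contMDiffAt.continuousAt.eventually_ne hdet] with y ⟨h1, h2⟩ h3
  conv_lhs => rw [h2]
  refine Finset.sum_congr rfl fun i _ ↦ ?_
  have : (G y).det * c i y (X y) = ((G y).updateCol i (k y)).det := by
    rw [← Matrix.cramer_apply, ← h1, Matrix.cramer_eq_adjugate_mulVec, Matrix.mulVec_mulVec,
      Matrix.adjugate_mul, Matrix.smul_mulVec, Matrix.one_mulVec]
    simp
  simp only [Pi.smul_apply']
  rw [← this, inv_mul_cancel_left₀ h3]

theorem inner_gradient (f : M → ℝ) (x : M) (a : TangentSpace I x) :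
    g.inner x (g.gradient f x) a = d% f x a := by
  simp [gradient, inner_sharp]

theorem smooth_gradient [Nontrivial E] (hf : SmoothFunNear I f x) :
    SmoothNear I (g.gradient f) x :=
  g.smoothNear_of_inner fun Z hZ ↦ by simpa only [inner_gradient] using hf.d hZ

variable [CompleteSpace E]

/-- The covariant derivative `∇_X Y` of a vector field along a vector field. -/
def nabla (X Y : Π x : M, TangentSpace I x) (x : M) : TangentSpace I x := g.leviCivita Y x (X x)

theorem smooth_koszul [Nontrivial E] (hX : SmoothNear I X x) (hY : SmoothNear I Y x)
    (hZ : SmoothNear I Z x) : SmoothFunNear I (g.koszul X Y Z) x := by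
  have h1 := (g.smooth_inner hY hZ).d hX
  have h2 := (g.smooth_inner hX hZ).d hY
  have h3 := (g.smooth_inner hX hY).d hZ
  have h4 := g.smooth_inner (hX.mlieBracket hY) hZ
  have h5 := g.smooth_inner (hX.mlieBracket hZ) hY
  have h6 := g.smooth_inner (hY.mlieBracket hZ) hX
  exact ((((h1.add h2).sub h3).add h4).sub h5).sub h6

theorem smooth_nabla [Nontrivial E] (hX : SmoothNear I X x) (hY : SmoothNear I Y x) :
    SmoothNear I (g.nabla X Y) x := by
  refine g.smoothNear_of_inner fun Z hZ ↦ ?_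
  refine ((SmoothFunNear.const (1 / 2)).mul (g.smooth_koszul hX hY hZ)).congr ?_
  filter_upwards [hX.eventually, hY.eventually, hZ.eventually] with y h1 h2 h3
  rw [← g.inner_leviCivita h1.mdifferentiableAt h2.mdifferentiableAt h3.mdifferentiableAt, nabla]
  ring

theorem leviCivita_congr (hX : SmoothNear I X x) (h : ∀ᶠ y in 𝓝 x, Y y = X y) :
    g.leviCivita Y x = g.leviCivita X x :=
  g.leviCivita.isCovariantDerivativeOnUniv.congr_of_eventuallyEq (hX.congr h).mdifferentiableAt
    hX.mdifferentiableAt Filter.univ_mem h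

theorem leviCivita_add (hX : SmoothNear I X x) (hY : SmoothNear I Y x) :
    g.leviCivita (X + Y) x = g.leviCivita X x + g.leviCivita Y x :=
  g.leviCivita.isCovariantDerivativeOnUniv.add hX.mdifferentiableAt hY.mdifferentiableAt

theorem leviCivita_smul (hf : SmoothFunNear I f x) (hX : SmoothNear I X x)
    (a : TangentSpace I x) :
    g.leviCivita (f • X) x a = f x • g.leviCivita X x a + d% f x a • X x := by
  rw [g.leviCivita.isCovariantDerivativeOnUniv.leibniz hX.mdifferentiableAt hf.mdifferentiableAt]
  simp

theorem leviCivita_neg (hX : SmoothNear I X x) (a : TangentSpace I x) :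
    g.leviCivita (-X) x a = -g.leviCivita X x a := by
  have := g.leviCivita_smul (SmoothFunNear.const (-1)) hX a
  rw [mvfderiv_const] at this
  have e : (fun _ : M ↦ (-1 : ℝ)) • X = -X := by ext y : 1; simp
  rw [e] at this
  simpa using this

theorem leviCivita_sub (hX : SmoothNear I X x) (hY : SmoothNear I Y x) (a : TangentSpace I x) :
    g.leviCivita (X - Y) x a = g.leviCivita X x a - g.leviCivita Y x a := by
  rw [sub_eq_add_neg, g.leviCivita_add hX hY.neg, _root_.add_apply, g.leviCivita_neg hY,
    sub_eq_add_neg]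

end LorentzianMetric

theorem mvfderiv_congr {E : Type*} [NormedAddCommGroup E] [NormedSpace ℝ E]
    {H : Type*} [TopologicalSpace H] {I : ModelWithCorners ℝ E H}
    {M : Type*} [TopologicalSpace M] [ChartedSpace H M] {f f' : M → ℝ} {x : M}
    (h : ∀ᶠ y in 𝓝 x, f y = f' y) : d% f x = d% f' x := by
  have h1 := Filter.EventuallyEq.mfderiv_eq (I := I) (I' := 𝓘(ℝ)) h
  ext v
  exact DFunLike.congr_fun h1 v

namespace LorentzianMetric

variable {E : Type*} [NormedAddCommGroup E] [NormedSpace ℝ E] [FiniteDimensional ℝ E]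
  [CompleteSpace E]
  {H : Type*} [TopologicalSpace H] {I : ModelWithCorners ℝ E H}
  {M : Type*} [TopologicalSpace M] [ChartedSpace H M] [IsManifold I ∞ M]
  (g : LorentzianMetric I M)
  {X X' Y Y' Z U V W : Π x : M, TangentSpace I x} {x : M} {f f' : M → ℝ}

theorem d_inner (hX : SmoothNear I X x) (hY : SmoothNear I Y x) (a : TangentSpace I x) :
    d% (fun y ↦ g.inner y (X y) (Y y)) x a
      = g.inner x (g.leviCivita X x a) (Y x) + g.inner x (X x) (g.leviCivita Y x a) :=
  g.leviCivita_metric hX.mdifferentiableAt hY.mdifferentiableAt a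

theorem nabla_sub_nabla (hX : SmoothNear I X x) (hY : SmoothNear I Y x) :
    g.nabla X Y x - g.nabla Y X x = mlieBracket I X Y x :=
  g.leviCivita_torsion hX.mdifferentiableAt hY.mdifferentiableAt

/-- The curvature operator on vector fields, `∇_U ∇_V W - ∇_V ∇_U W - ∇_[U, V] W`. -/
def curvatureField (U V W : Π x : M, TangentSpace I x) : Π x : M, TangentSpace I x :=
  g.nabla U (g.nabla V W) - g.nabla V (g.nabla U W) - g.nabla (mlieBracket I U V) W

theorem curvatureField_swap : g.curvatureField U V W x = -g.curvatureField V U W x := by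
  have : mlieBracket I U V x = -mlieBracket I V U x := mlieBracket_swap_apply
  simp only [curvatureField, Pi.sub_apply, nabla, this, map_neg]
  abel

theorem nabla_congr (hX : SmoothNear I X x) (h : ∀ᶠ y in 𝓝 x, Y y = X y) :
    g.nabla U Y x = g.nabla U X x := by
  rw [nabla, nabla, g.leviCivita_congr hX h]

theorem nabla_add_right (hX : SmoothNear I X x) (hY : SmoothNear I Y x) :
    g.nabla U (X + Y) x = g.nabla U X x + g.nabla U Y x := by
  rw [nabla, g.leviCivita_add hX hY]; rfl

theorem nabla_sub_right (hX : SmoothNear I X x) (hY : SmoothNear I Y x) :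
    g.nabla U (X - Y) x = g.nabla U X x - g.nabla U Y x :=
  g.leviCivita_sub hX hY _

theorem nabla_smul_right (hf : SmoothFunNear I f x) (hX : SmoothNear I X x) :
    g.nabla U (f • X) x = f x • g.nabla U X x + d% f x (U x) • X x :=
  g.leviCivita_smul hf hX _

theorem nabla_add_left : g.nabla (U + V) X = g.nabla U X + g.nabla V X := by
  ext y : 1; simp [nabla]

theorem nabla_smul_left : g.nabla (f • U) X = f • g.nabla U X := by
  ext y : 1; simp [nabla]

variable [Nontrivial E]

theorem smooth_curvatureField (hU : SmoothNear I U x) (hV : SmoothNear I V x)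
    (hW : SmoothNear I W x) : SmoothNear I (g.curvatureField U V W) x :=
  ((g.smooth_nabla hU (g.smooth_nabla hV hW)).sub (g.smooth_nabla hV (g.smooth_nabla hU hW))).sub
    (g.smooth_nabla (hU.mlieBracket hV) hW)

theorem curvatureField_add_left (hX : SmoothNear I X x) (hX' : SmoothNear I X' x)
    (hW : SmoothNear I W x) :
    g.curvatureField (X + X') V W x = g.curvatureField X V W x + g.curvatureField X' V W x := by
  simp only [curvatureField, Pi.sub_apply]
  rw [g.nabla_add_left, g.nabla_add_left,
    g.nabla_add_right (g.smooth_nabla hX hW) (g.smooth_nabla hX' hW)]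
  have : g.nabla (mlieBracket I (X + X') V) W x
      = g.nabla (mlieBracket I X V) W x + g.nabla (mlieBracket I X' V) W x := by
    simp only [nabla]
    rw [mlieBracket_add_left hX.mdifferentiableAt hX'.mdifferentiableAt, map_add]
  rw [this]
  simp only [Pi.add_apply]
  abel

theorem curvatureField_smul_left (hf : SmoothFunNear I f x) (hX : SmoothNear I X x)
    (hW : SmoothNear I W x) :
    g.curvatureField (f • X) V W x = f x • g.curvatureField X V W x := by
  simp only [curvatureField, Pi.sub_apply]
  rw [g.nabla_smul_left, g.nabla_smul_left,
    g.nabla_smul_right hf (g.smooth_nabla hX hW)]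
  have : g.nabla (mlieBracket I (f • X) V) W x
      = -(d% f x (V x) • g.nabla X W x) + f x • g.nabla (mlieBracket I X V) W x := by
    simp only [nabla]
    rw [mlieBracket_smul_left hf.mdifferentiableAt hX.mdifferentiableAt, map_add, map_smul,
      map_smul, neg_smul]
  rw [this]
  simp only [Pi.smul_apply', smul_sub]
  abel

theorem curvatureField_add_right (hU : SmoothNear I U x) (hV : SmoothNear I V x)
    (hX : SmoothNear I X x) (hX' : SmoothNear I X' x) :
    g.curvatureField U V (X + X') x = g.curvatureField U V X x + g.curvatureField U V X' x := by
  have h' {V : Π x : M, TangentSpace I x} (hV : SmoothNear I V x)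
      (U : Π x : M, TangentSpace I x) :
      g.nabla U (g.nabla V (X + X')) x = g.nabla U (g.nabla V X) x + g.nabla U (g.nabla V X') x := by
    rw [← g.nabla_add_right (g.smooth_nabla hV hX) (g.smooth_nabla hV hX')]
    refine g.nabla_congr ((g.smooth_nabla hV hX).add (g.smooth_nabla hV hX')) ?_
    filter_upwards [hX.eventually, hX'.eventually] with y h1 h2 using g.nabla_add_right h1 h2
  simp only [curvatureField, Pi.sub_apply]
  rw [h' hV U, h' hU V, g.nabla_add_right hX hX']
  abel

theorem curvatureField_smul_right (hf : SmoothFunNear I f x) (hU : SmoothNear I U x)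
    (hV : SmoothNear I V x) (hX : SmoothNear I X x) :
    g.curvatureField U V (f • X) x = f x • g.curvatureField U V X x := by
  have h {V : Π x : M, TangentSpace I x} (hV : SmoothNear I V x)
      (U : Π x : M, TangentSpace I x) :
      g.nabla U (g.nabla V (f • X)) x = f x • g.nabla U (g.nabla V X) x
        + d% f x (U x) • g.nabla V X x + (d% f x (V x) • g.nabla U X x
        + d% (fun y ↦ d% f y (V y)) x (U x) • X x) := by
    have h1 := SmoothNear.smul hf (g.smooth_nabla hV hX)
    have h2 := SmoothNear.smul (hf.d hV) hX
    rw [← g.nabla_smul_right hf (g.smooth_nabla hV hX),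
      ← g.nabla_smul_right (hf.d hV) hX, ← g.nabla_add_right h1 h2]
    refine g.nabla_congr (h1.add h2) ?_
    filter_upwards [hf.eventually, hX.eventually] with y h1 h2 using g.nabla_smul_right h1 h2
  simp only [curvatureField, Pi.sub_apply]
  rw [h hV U, h hU V, g.nabla_smul_right hf hX, d_mlieBracket hf hU hV, sub_smul]
  simp only [smul_sub]
  abel

/-- The curvature tensor is given by the curvature operator on smooth vector fields. -/
theorem curvature_apply (hU : SmoothNear I U x) (hV : SmoothNear I V x) (hW : SmoothNear I W x) :
    g.curvature x (U x) (V x) (W x) = g.curvatureField U V W x := by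
  have hU' := SmoothNear.extend (U x)
  have hV' := SmoothNear.extend (V x)
  have hW' := SmoothNear.extend (W x)
  have e0 : g.curvature x (U x) (V x) (W x)
    = g.curvatureField (extend E (U x)) (extend E (V x)) (extend E (W x)) x := by
    simp [curvature, curvatureField, nabla]; rfl
  rw [e0]
  have e1 := SmoothNear.tensorial (Φ := fun X ↦ g.curvatureField X (extend E (V x))
    (extend E (W x)) x) (fun h h' ↦ g.curvatureField_add_left h h' hW')
    (fun hf h ↦ g.curvatureField_smul_left hf h hW') hU' hU (extend_apply_self ..)
  have e2 := SmoothNear.tensorial (Φ := fun X ↦ g.curvatureField X U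
    (extend E (W x)) x) (fun h h' ↦ g.curvatureField_add_left h h' hW')
    (fun hf h ↦ g.curvatureField_smul_left hf h hW') hV' hV (extend_apply_self ..)
  have e3 := SmoothNear.tensorial (Φ := fun X ↦ g.curvatureField U V X x)
    (fun h h' ↦ g.curvatureField_add_right hU hV h h')
    (fun hf h ↦ g.curvatureField_smul_right hf hU hV h) hW' hW (extend_apply_self ..)
  rw [e1, g.curvatureField_swap, e2, ← g.curvatureField_swap, e3]

theorem curvature_swap (u v w : TangentSpace I x) :
    g.curvature x u v w = -g.curvature x v u w := by
  have hu := SmoothNear.extend u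
  have hv := SmoothNear.extend v
  have hw := SmoothNear.extend w
  have e1 := g.curvature_apply hu hv hw
  have e2 := g.curvature_apply hv hu hw
  rw [g.curvatureField_swap, ← e2] at e1
  simpa only [extend_apply_self] using e1

theorem curvature_add_left (u u' v w : TangentSpace I x) :
    g.curvature x (u + u') v w = g.curvature x u v w + g.curvature x u' v w := by
  have hu := SmoothNear.extend u
  have hu' := SmoothNear.extend u'
  have hv := SmoothNear.extend v
  have hw := SmoothNear.extend w
  have e := g.curvatureField_add_left hu hu' hw (V := extend E v)
  rw [← g.curvature_apply hu hv hw, ← g.curvature_apply hu' hv hw,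
    ← g.curvature_apply (hu.add hu') hv hw] at e
  simpa only [extend_apply_self, Pi.add_apply] using e

theorem curvature_smul_left (c : ℝ) (u v w : TangentSpace I x) :
    g.curvature x (c • u) v w = c • g.curvature x u v w := by
  have hu := SmoothNear.extend u
  have hv := SmoothNear.extend v
  have hw := SmoothNear.extend w
  have hc := SmoothFunNear.const (I := I) (x := x) c
  have e := g.curvatureField_smul_left hc hu hw (V := extend E v)
  rw [← g.curvature_apply hu hv hw, ← g.curvature_apply (SmoothNear.smul hc hu) hv hw] at e
  simpa only [extend_apply_self, Pi.smul_apply'] using e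

theorem curvature_add_middle (u v v' w : TangentSpace I x) :
    g.curvature x u (v + v') w = g.curvature x u v w + g.curvature x u v' w := by
  rw [g.curvature_swap, g.curvature_add_left, g.curvature_swap v, g.curvature_swap v']
  abel

theorem curvature_smul_middle (c : ℝ) (u v w : TangentSpace I x) :
    g.curvature x u (c • v) w = c • g.curvature x u v w := by
  rw [g.curvature_swap, g.curvature_smul_left, g.curvature_swap v]
  simp

theorem curvature_cyclic (u v w : TangentSpace I x) :
    g.curvature x u v w + g.curvature x v w u + g.curvature x w u v = 0 := by
  have hu := SmoothNear.extend u
  have hv := SmoothNear.extend v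
  have hw := SmoothNear.extend w
  have e1 := g.curvature_apply hu hv hw
  have e2 := g.curvature_apply hv hw hu
  have e3 := g.curvature_apply hw hu hv
  simp only [extend_apply_self] at e1 e2 e3
  rw [e1, e2, e3]
  set U : Π y : M, TangentSpace I y := extend E u
  set V : Π y : M, TangentSpace I y := extend E v
  set W : Π y : M, TangentSpace I y := extend E w
  have key {A B C : Π y : M, TangentSpace I y} (hA : SmoothNear I A x) (hB : SmoothNear I B x)
      (hC : SmoothNear I C x) : g.nabla A (g.nabla B C) x - g.nabla A (g.nabla C B) x
        - g.nabla (mlieBracket I B C) A x = mlieBracket I A (mlieBracket I B C) x := by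
    rw [← g.nabla_sub_nabla hA (hB.mlieBracket hC), ← g.nabla_sub_right (g.smooth_nabla hB hC)
      (g.smooth_nabla hC hB)]
    congr 1
    refine g.nabla_congr (hB.mlieBracket hC) ?_
    filter_upwards [hB.eventually, hC.eventually] with y h1 h2 using g.nabla_sub_nabla h1 h2
  have k1 := key hu hv hw
  have k2 := key hv hw hu
  have k3 := key hw hu hv
  have j : mlieBracket I U (mlieBracket I V W) x + mlieBracket I V (mlieBracket I W U) x
      + mlieBracket I W (mlieBracket I U V) x = 0 := by
    have j1 := hu.jacobi hv hw
    have s1 : mlieBracket I (mlieBracket I U V) W x = -mlieBracket I W (mlieBracket I U V) x :=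
      mlieBracket_swap_apply
    have s2 : mlieBracket I W U = -mlieBracket I U W := mlieBracket_swap
    have s3 : mlieBracket I V (-mlieBracket I U W) x = -mlieBracket I V (mlieBracket I U W) x := by
      have := mlieBracket_const_smul_right (I := I) (V := V) (c := (-1 : ℝ))
        (hu.mlieBracket hw).mdifferentiableAt
      simpa using this
    rw [j1, s1, s2, s3]
    abel
  rw [← k1, ← k2, ← k3] at j
  simp only [curvatureField, Pi.sub_apply]
  rw [← j]
  abel

theorem inner_curvature_skew (u v w z : TangentSpace I x) :
    g.inner x (g.curvature x u v w) z = -g.inner x w (g.curvature x u v z) := by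
  have hu := SmoothNear.extend u
  have hv := SmoothNear.extend v
  have hw := SmoothNear.extend w
  have hz := SmoothNear.extend z
  have e1 := g.curvature_apply hu hv hw
  have e2 := g.curvature_apply hu hv hz
  simp only [extend_apply_self] at e1 e2
  rw [e1, e2]
  have wx : (extend E w : Π y : M, TangentSpace I y) x = w := extend_apply_self ..
  have zx : (extend E z : Π y : M, TangentSpace I y) x = z := extend_apply_self ..
  set U : Π y : M, TangentSpace I y := extend E u
  set V : Π y : M, TangentSpace I y := extend E v
  set W : Π y : M, TangentSpace I y := extend E w
  set Z : Π y : M, TangentSpace I y := extend E z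
  have key {B : Π y : M, TangentSpace I y} (hB : SmoothNear I B x) (A : Π y : M, TangentSpace I y) :
      d% (fun y ↦ d% (fun y ↦ g.inner y (W y) (Z y)) y (B y)) x (A x)
      = g.inner x (g.nabla A (g.nabla B W) x) (Z x) + g.inner x (g.nabla B W x) (g.nabla A Z x)
        + (g.inner x (g.nabla A W x) (g.nabla B Z x)
          + g.inner x (W x) (g.nabla A (g.nabla B Z) x)) := by
    have hBW := g.smooth_nabla hB hw
    have hBZ := g.smooth_nabla hB hz
    have e : ∀ᶠ y in 𝓝 x, d% (fun y ↦ g.inner y (W y) (Z y)) y (B y)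
        = g.inner y (g.nabla B W y) (Z y) + g.inner y (W y) (g.nabla B Z y) := by
      filter_upwards [hw.eventually, hz.eventually] with y h1 h2 using g.d_inner h1 h2 _
    rw [mvfderiv_congr e, mvfderiv_fun_add (g.smooth_inner hBW hz).mdifferentiableAt
      (g.smooth_inner hw hBZ).mdifferentiableAt, _root_.add_apply,
      g.d_inner hBW hz, g.d_inner hw hBZ]
    rfl
  have h := d_mlieBracket (g.smooth_inner hw hz) hu hv
  rw [key hv U, key hu V, g.d_inner hw hz] at h
  simp only [curvatureField, Pi.sub_apply, map_sub, _root_.sub_apply]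
  rw [wx, zx] at h
  simp only [nabla] at h ⊢
  linarith

theorem inner_curvature_pair (u v w z : TangentSpace I x) :
    g.inner x (g.curvature x u v w) z = g.inner x (g.curvature x w z u) v := by
  have cyc (a b c d : TangentSpace I x) : g.inner x (g.curvature x a b c) d
      + g.inner x (g.curvature x b c a) d + g.inner x (g.curvature x c a b) d = 0 := by
    have := congrArg (fun t ↦ g.inner x t d) (g.curvature_cyclic a b c)
    simpa using this
  have s1 (a b c d : TangentSpace I x) :
      g.inner x (g.curvature x a b c) d = -g.inner x (g.curvature x b a c) d := by
    rw [g.curvature_swap]; simp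
  have s2 (a b c d : TangentSpace I x) :
      g.inner x (g.curvature x a b c) d = -g.inner x (g.curvature x a b d) c := by
    rw [g.inner_curvature_skew, g.symm]
  linarith [cyc u v w z, cyc v w z u, cyc w z u v, cyc z u v w,
    s1 u v w z, s2 u v w z, s1 v w u z, s2 v w u z, s1 w u v z, s2 w u v z,
    s1 v w z u, s2 v w z u, s1 w z v u, s2 w z v u, s1 z v w u, s2 z v w u,
    s1 w z u v, s2 w z u v, s1 z u w v, s2 z u w v, s1 u w z v, s2 u w z v,
    s1 z u v w, s2 z u v w, s1 u v z w, s2 u v z w, s1 v z u w, s2 v z u w]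

/-- The second Bianchi identity. -/
theorem curvatureField_bianchi (hU : SmoothNear I U x) (hV : SmoothNear I V x)
    (hW : SmoothNear I W x) (hZ : SmoothNear I Z x) :
    (g.nabla U (g.curvatureField V W Z) x - g.curvatureField V W (g.nabla U Z) x
        - g.curvatureField (mlieBracket I U V) W Z x)
      + (g.nabla V (g.curvatureField W U Z) x - g.curvatureField W U (g.nabla V Z) x
        - g.curvatureField (mlieBracket I V W) U Z x)
      + (g.nabla W (g.curvatureField U V Z) x - g.curvatureField U V (g.nabla W Z) x
        - g.curvatureField (mlieBracket I W U) V Z x) = 0 := by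
  have key {A B C : Π y : M, TangentSpace I y} (hB : SmoothNear I B x)
      (hC : SmoothNear I C x) : g.nabla A (g.curvatureField B C Z) x
        = g.nabla A (g.nabla B (g.nabla C Z)) x - g.nabla A (g.nabla C (g.nabla B Z)) x
          - g.nabla A (g.nabla (mlieBracket I B C) Z) x := by
    have h1 := g.smooth_nabla hB (g.smooth_nabla hC hZ)
    have h2 := g.smooth_nabla hC (g.smooth_nabla hB hZ)
    rw [curvatureField, g.nabla_sub_right (h1.sub h2) (g.smooth_nabla (hB.mlieBracket hC) hZ),
      g.nabla_sub_right h1 h2]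
  have j : g.nabla (mlieBracket I (mlieBracket I U V) W) Z x
      + g.nabla (mlieBracket I (mlieBracket I V W) U) Z x
      + g.nabla (mlieBracket I (mlieBracket I W U) V) Z x = 0 := by
    have j1 := hU.jacobi hV hW
    have s1 : mlieBracket I U (mlieBracket I V W) x = -mlieBracket I (mlieBracket I V W) U x :=
      mlieBracket_swap_apply
    have s2 : mlieBracket I U W = (-1 : ℝ) • mlieBracket I W U := by
      rw [mlieBracket_swap]; simp
    have s3 : mlieBracket I V ((-1 : ℝ) • mlieBracket I W U) x
        = mlieBracket I (mlieBracket I W U) V x := by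
      rw [mlieBracket_const_smul_right (hW.mlieBracket hU).mdifferentiableAt,
        mlieBracket_swap_apply]
      simp
    rw [s1, s2, s3] at j1
    simp only [nabla]
    rw [← map_add, ← map_add]
    rw [add_right_comm, ← j1, neg_add_cancel, map_zero]
  rw [key hV hW, key hW hU, key hU hV]
  simp only [curvatureField, Pi.sub_apply]
  rw [← j]
  abel

end LorentzianMetric

namespace LorentzianMetric

variable {E : Type*} [NormedAddCommGroup E] [NormedSpace ℝ E] [FiniteDimensional ℝ E]
  [CompleteSpace E]
  {H : Type*} [TopologicalSpace H] {I : ModelWithCorners ℝ E H}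
  {M : Type*} [TopologicalSpace M] [ChartedSpace H M] [IsManifold I ∞ M]
  (g : LorentzianMetric I M)
  {X X' Y Y' Z U V W : Π x : M, TangentSpace I x} {x : M} {f f' : M → ℝ}

theorem leviCivita_sum {ι : Type*} (s : Finset ι) {F : ι → Π x : M, TangentSpace I x}
    (h : ∀ i ∈ s, SmoothNear I (F i) x) (a : TangentSpace I x) :
    g.leviCivita (fun y ↦ ∑ i ∈ s, F i y) x a = ∑ i ∈ s, g.leviCivita (F i) x a := by
  classical
  induction s using Finset.induction_on with
  | empty =>
    have := g.leviCivita.zero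
    simp only [Finset.sum_empty]
    exact DFunLike.congr_fun (congrFun this x) a
  | insert b s hb ih =>
    simp only [Finset.sum_insert hb]
    rw [← ih fun i hi ↦ h i (by simp [hi]), ← _root_.add_apply,
      ← g.leviCivita_add (h b (by simp)) (SmoothNear.sum fun i hi ↦ h i (by simp [hi]))]
    rfl

/-- Covariant differentiation commutes with the trace of an endomorphism field: if `L` is the
covariant derivative of `T` along `a`, then the derivative of `tr T` along `a` is `tr L`. -/
theorem d_trace (T : Π y : M, TangentSpace I y →ₗ[ℝ] TangentSpace I y)
    (hT : ∀ X, SmoothNear I X x → SmoothNear I (fun y ↦ T y (X y)) x) (a : TangentSpace I x)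
    (L : TangentSpace I x →ₗ[ℝ] TangentSpace I x)
    (hL : ∀ X, SmoothNear I X x →
      L (X x) = g.leviCivita (fun y ↦ T y (X y)) x a - T x (g.leviCivita X x a)) :
    d% (fun y ↦ LinearMap.trace ℝ (TangentSpace I y) (T y)) x a
      = LinearMap.trace ℝ (TangentSpace I x) L := by
  obtain ⟨e, c, he, hc, hb⟩ := exists_smooth_frame (I := I) x
  have trace_eq (y : M) (b : Module.Basis (Fin (Module.finrank ℝ E)) ℝ (TangentSpace I y))
      (A : TangentSpace I y →ₗ[ℝ] TangentSpace I y) :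
      LinearMap.trace ℝ (TangentSpace I y) A = ∑ i, b.coord i (A (b i)) := by
    rw [LinearMap.trace_eq_matrix_trace ℝ b, Matrix.trace]
    simp [LinearMap.toMatrix_apply]
  have e1 : ∀ᶠ y in 𝓝 x, LinearMap.trace ℝ (TangentSpace I y) (T y)
      = ∑ i, c i y (T y (e i y)) := by
    filter_upwards [hb] with y ⟨b, hb⟩
    rw [trace_eq y b]
    simp [hb]
  have hcT (i) : SmoothFunNear I (fun y ↦ c i y (T y (e i y))) x := hc i _ (hT _ (he i))
  have dsum (s : Finset (Fin (Module.finrank ℝ E))) :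
      d% (fun y ↦ ∑ i ∈ s, c i y (T y (e i y))) x a
        = ∑ i ∈ s, d% (fun y ↦ c i y (T y (e i y))) x a := by
    classical
    induction s using Finset.induction_on with
    | empty => simp [mvfderiv_const]
    | insert i s hi ih =>
      simp only [Finset.sum_insert hi]
      rw [mvfderiv_fun_add (hcT i).mdifferentiableAt
        (SmoothFunNear.sum fun j _ ↦ hcT j).mdifferentiableAt, _root_.add_apply, ih]
  obtain ⟨b, hb'⟩ := hb.self_of_nhds
  have coeff (X) (hX : SmoothNear I X x) (k) : b.coord k (g.leviCivita X x a)
      = d% (fun y ↦ c k y (X y)) x a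
        + ∑ j, b.coord j (X x) * b.coord k (g.leviCivita (e j) x a) := by
    have hs (j) : SmoothNear I ((fun y ↦ c j y (X y)) • e j) x := SmoothNear.smul (hc j X hX) (he j)
    have h1 : ∀ᶠ y in 𝓝 x, X y = ∑ j, ((fun y ↦ c j y (X y)) • e j) y := by
      filter_upwards [hb] with y ⟨b, hb⟩
      conv_lhs => rw [← b.sum_repr (X y)]
      simp [hb]
    rw [g.leviCivita_congr (SmoothNear.sum fun j _ ↦ hs j) h1, g.leviCivita_sum _ fun j _ ↦ hs j,
      map_sum]
    simp only [g.leviCivita_smul (hc _ X hX) (he _), map_add, map_smul, smul_eq_mul,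
      Finset.sum_add_distrib, (hb' _).1, (hb' _).2]
    rw [add_comm]
    congr 1
    simp [Finsupp.single_apply]
  rw [mvfderiv_congr e1, dsum, trace_eq x b]
  have step (i) : b.coord i (L (b i)) = d% (fun y ↦ c i y (T y (e i y))) x a
      + ∑ j, b.coord j (T x (b i)) * b.coord i (g.leviCivita (e j) x a)
      - b.coord i (T x (g.leviCivita (e i) x a)) := by
    have := coeff _ (hT _ (he i)) i
    rw [← (hb' i).1, hL _ (he i), map_sub, this]
  simp only [step, Finset.sum_sub_distrib, Finset.sum_add_distrib]
  rw [Finset.sum_comm, add_sub_assoc, left_eq_add, sub_eq_zero]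
  refine Finset.sum_congr rfl fun j _ ↦ ?_
  conv_rhs => rw [← b.sum_repr (g.leviCivita (e j) x a)]
  simp only [map_sum, map_smul, smul_eq_mul, Module.Basis.coord_apply]
  exact Finset.sum_congr rfl fun i _ ↦ mul_comm _ _

variable [Nontrivial E]

/-- The endomorphism `u ↦ R(u, v)w`, whose trace is the Ricci tensor. -/
def curvatureEnd (x : M) (v w : TangentSpace I x) : TangentSpace I x →ₗ[ℝ] TangentSpace I x where
  toFun u := g.curvature x u v w
  map_add' u u' := g.curvature_add_left u u' v w
  map_smul' c u := g.curvature_smul_left c u v w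

theorem ricci_eq_trace (v w : TangentSpace I x) :
    g.ricci x v w = LinearMap.trace ℝ (TangentSpace I x) (g.curvatureEnd x v w) := by
  rw [LinearMap.trace_eq_matrix_trace ℝ (Module.finBasis ℝ (TangentSpace I x)), Matrix.trace]
  simp [LinearMap.toMatrix_apply, ricci, curvatureEnd]

end LorentzianMetric

namespace LorentzianAlmostParacontact

variable {E : Type*} [NormedAddCommGroup E] [NormedSpace ℝ E]
  {H : Type*} [TopologicalSpace H] {I : ModelWithCorners ℝ E H}
  {M : Type*} [TopologicalSpace M] [ChartedSpace H M] [IsManifold I ∞ M]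
  {g : LorentzianMetric I M} (P : LorentzianAlmostParacontact g)
  {X Y Z U V W : Π x : M, TangentSpace I x} {x : M}

theorem smooth_ζ : SmoothNear I P.ζ x := Filter.Eventually.of_forall fun y ↦ P.contMDiff_ζ y

theorem ν_ζ_eq : P.ν x (P.ζ x) = -1 := by linarith [P.ν_ζ x]

theorem inner_ζ_left (a : TangentSpace I x) : g.inner x (P.ζ x) a = P.ν x a := by
  rw [g.symm, P.inner_ζ]

theorem smooth_ν (hX : SmoothNear I X x) : SmoothFunNear I (fun y ↦ P.ν y (X y)) x := by
  simpa only [P.inner_ζ] using g.smooth_inner hX (P.smooth_ζ (x := x))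

variable [FiniteDimensional ℝ E] [CompleteSpace E] {P} (hP : P.IsLPKenmotsu)

include hP

theorem IsLPKenmotsu.leviCivita_ζ (a : TangentSpace I x) :
    g.leviCivita P.ζ x a = -a - P.ν x a • P.ζ x := by
  have h1 := hP P.ζ x P.smooth_ζ.mdifferentiableAt a
  have h2 : g.leviCivita (fun y ↦ P.φ y (P.ζ y)) x a = 0 := by
    have : (fun y ↦ P.φ y (P.ζ y)) = 0 := by ext y : 1; exact P.φ_ζ y
    rw [this, g.leviCivita.zero]
    rfl
  have h3 : P.ν x (g.leviCivita P.ζ x a) = 0 := by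
    have h := g.d_inner P.smooth_ζ P.smooth_ζ a
    have hc : (fun y ↦ g.inner y (P.ζ y) (P.ζ y)) = fun _ ↦ (-1 : ℝ) := by
      ext y; rw [P.inner_ζ, P.ν_ζ_eq]
    rw [hc, mvfderiv_const, P.inner_ζ, P.inner_ζ_left] at h
    simp only [_root_.zero_apply] at h
    linarith
  rw [h2, P.inner_ζ, P.ν_φ, P.ν_ζ_eq] at h1
  have h4 : P.φ x (g.leviCivita P.ζ x a) = -P.φ x a := by
    simpa [neg_eq_iff_eq_neg] using h1
  have h5 := congrArg (P.φ x) h4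
  rw [P.φ_φ, h3, map_neg, P.φ_φ, zero_smul, add_zero] at h5
  rw [h5, neg_add, sub_eq_add_neg]

theorem IsLPKenmotsu.d_ν (hX : SmoothNear I X x) (a : TangentSpace I x) :
    d% (fun y ↦ P.ν y (X y)) x a
      = P.ν x (g.leviCivita X x a) - g.inner x a (X x) - P.ν x a * P.ν x (X x) := by
  have h := g.d_inner hX P.smooth_ζ a
  simp only [P.inner_ζ] at h
  rw [h, hP.leviCivita_ζ]
  simp only [map_sub, map_neg, map_smul, P.inner_ζ, smul_eq_mul]
  rw [g.symm x (X x)]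
  ring

variable [Nontrivial E]

theorem IsLPKenmotsu.curvature_ζ (u v : TangentSpace I x) :
    g.curvature x u v (P.ζ x) = P.ν x v • u - P.ν x u • v := by
  have hu := SmoothNear.extend u
  have hv := SmoothNear.extend v
  have hζ := P.smooth_ζ (x := x)
  have e1 := g.curvature_apply hu hv hζ
  simp only [extend_apply_self] at e1
  rw [e1]
  have ux : (extend E u : Π y : M, TangentSpace I y) x = u := extend_apply_self ..
  have vx : (extend E v : Π y : M, TangentSpace I y) x = v := extend_apply_self ..
  set U : Π y : M, TangentSpace I y := extend E u
  set V : Π y : M, TangentSpace I y := extend E v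
  have key {B : Π y : M, TangentSpace I y} (hB : SmoothNear I B x)
      (a : TangentSpace I x) : g.leviCivita (g.nabla B P.ζ) x a
        = -g.leviCivita B x a - (P.ν x (B x) • g.leviCivita P.ζ x a
          + (P.ν x (g.leviCivita B x a) - g.inner x a (B x) - P.ν x a * P.ν x (B x)) • P.ζ x) := by
    have e : g.nabla B P.ζ = -B - (fun y ↦ P.ν y (B y)) • P.ζ := by
      ext y : 1
      simp [LorentzianMetric.nabla, hP.leviCivita_ζ]
    rw [e, g.leviCivita_sub hB.neg (SmoothNear.smul (P.smooth_ν hB) hζ), g.leviCivita_neg hB,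
      g.leviCivita_smul (P.smooth_ν hB) hζ, hP.d_ν hB]
  have br := g.nabla_sub_nabla hu hv
  refine g.eq_of_inner_eq fun w ↦ ?_
  simp only [LorentzianMetric.curvatureField, Pi.sub_apply]
  rw [LorentzianMetric.nabla, LorentzianMetric.nabla, LorentzianMetric.nabla, key hv, key hu,
    ← br, LorentzianMetric.nabla, LorentzianMetric.nabla]
  simp only [hP.leviCivita_ζ, ux, vx, map_sub, map_neg, map_add, map_smul, _root_.sub_apply,
    _root_.neg_apply, _root_.add_apply, _root_.smul_apply, smul_eq_mul]
  rw [g.symm x v u]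
  ring

theorem IsLPKenmotsu.curvature_ζ_left (u w : TangentSpace I x) :
    g.curvature x (P.ζ x) u w = g.inner x u w • P.ζ x - P.ν x w • u := by
  refine g.eq_of_inner_eq fun z ↦ ?_
  rw [g.inner_curvature_pair, hP.curvature_ζ]
  simp only [map_sub, map_smul, _root_.sub_apply, _root_.smul_apply, smul_eq_mul, P.inner_ζ_left]
  rw [g.symm x w u, g.symm x z u]
  ring

theorem IsLPKenmotsu.ricci_ζ (v : TangentSpace I x) :
    g.ricci x v (P.ζ x) = ((Module.finrank ℝ E : ℝ) - 1) * P.ν x v := by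
  have e : g.curvatureEnd x v (P.ζ x)
      = P.ν x v • LinearMap.id - (P.ν x).toLinearMap.smulRight v := by
    ext u
    simp [LorentzianMetric.curvatureEnd, hP.curvature_ζ]
  rw [g.ricci_eq_trace, e, map_sub, map_smul, LinearMap.trace_id, LinearMap.trace_smulRight]
  change P.ν x v * (Module.finrank ℝ E : ℝ) - P.ν x v = _
  ring

theorem IsLPKenmotsu.nabla_ζ_curvature (hU : SmoothNear I U x) (hV : SmoothNear I V x)
    (hW : SmoothNear I W x) :
    g.leviCivita (g.curvatureField U V W) x (P.ζ x)
      - g.curvature x (g.leviCivita U x (P.ζ x)) (V x) (W x)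
      - g.curvature x (U x) (g.leviCivita V x (P.ζ x)) (W x)
      - g.curvature x (U x) (V x) (g.leviCivita W x (P.ζ x))
      = (2 : ℝ) • (g.curvature x (U x) (V x) (W x)
        - (g.inner x (V x) (W x) • U x - g.inner x (U x) (W x) • V x)) := by
  have hζ := P.smooth_ζ (x := x)
  have B := g.curvatureField_bianchi hζ hU hV hW
  have br {A : Π y : M, TangentSpace I y} (hA : SmoothNear I A x) : mlieBracket I P.ζ A x
      = g.leviCivita A x (P.ζ x) + A x + P.ν x (A x) • P.ζ x := by
    rw [← g.nabla_sub_nabla hζ hA, LorentzianMetric.nabla, LorentzianMetric.nabla,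
      hP.leviCivita_ζ]
    abel
  have br' : mlieBracket I V P.ζ x
      = (-1 : ℝ) • (g.leviCivita V x (P.ζ x) + V x + P.ν x (V x) • P.ζ x) := by
    rw [← br hV, neg_one_smul]; exact mlieBracket_swap_apply
  have der {A : Π y : M, TangentSpace I y} (hA : SmoothNear I A x) (a : TangentSpace I x) :
      g.leviCivita (g.curvatureField P.ζ A W) x a
        = g.inner x (A x) (W x) • g.leviCivita P.ζ x a
          + (g.inner x (g.leviCivita A x a) (W x) + g.inner x (A x) (g.leviCivita W x a)) • P.ζ x
          - (P.ν x (W x) • g.leviCivita A x a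
            + (P.ν x (g.leviCivita W x a) - g.inner x a (W x) - P.ν x a * P.ν x (W x)) • A x) := by
    have h1 := SmoothNear.smul (g.smooth_inner hA hW) hζ
    have h2 := SmoothNear.smul (P.smooth_ν hW) hA
    have e : ∀ᶠ y in 𝓝 x, g.curvatureField P.ζ A W y
        = ((fun y ↦ g.inner y (A y) (W y)) • P.ζ - (fun y ↦ P.ν y (W y)) • A) y := by
      filter_upwards [hA.eventually, hW.eventually] with y hAy hWy
      rw [← g.curvature_apply P.smooth_ζ hAy hWy, hP.curvature_ζ_left]
      rfl
    rw [g.leviCivita_congr (h1.sub h2) e, g.leviCivita_sub h1 h2,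
      g.leviCivita_smul (g.smooth_inner hA hW) hζ, g.leviCivita_smul (P.smooth_ν hW) hA,
      hP.d_ν hW, g.d_inner hA hW]
  have der' (a : TangentSpace I x) : g.leviCivita (g.curvatureField V P.ζ W) x a
      = -g.leviCivita (g.curvatureField P.ζ V W) x a := by
    rw [← g.leviCivita_neg (g.smooth_curvatureField hζ hV hW)]
    congr 2
    ext y : 1
    exact g.curvatureField_swap
  rw [← g.curvature_apply hU hV (g.smooth_nabla hζ hW),
    ← g.curvature_apply (hζ.mlieBracket hU) hV hW,
    ← g.curvature_apply hV hζ (g.smooth_nabla hU hW),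
    ← g.curvature_apply (hU.mlieBracket hV) hζ hW,
    ← g.curvature_apply hζ hU (g.smooth_nabla hV hW),
    ← g.curvature_apply (hV.mlieBracket hζ) hU hW] at B
  rw [br', br hU, g.curvature_swap ((-1 : ℝ) • _), g.curvature_swap (V x), g.curvature_swap (mlieBracket ..),
    ← g.nabla_sub_nabla hU hV] at B
  simp only [LorentzianMetric.nabla, der', der hV, der hU, hP.curvature_ζ_left,
    g.curvature_add_left, g.curvature_smul_left, g.curvature_add_middle, g.curvature_smul_middle,
    hP.leviCivita_ζ] at B
  rw [g.curvature_swap (U x) (P.ζ x), hP.curvature_ζ_left] at B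
  refine g.eq_of_inner_eq fun w ↦ ?_
  replace B := congrArg (fun t ↦ g.inner x t w) B
  simp only [map_sub, map_neg, map_add, map_smul, map_zero, _root_.sub_apply, _root_.zero_apply,
    _root_.neg_apply, _root_.add_apply, _root_.smul_apply, smul_eq_mul] at B ⊢
  linear_combination B

theorem IsLPKenmotsu.nabla_ζ_ricci (hV : SmoothNear I V x) (hW : SmoothNear I W x) :
    d% (fun y ↦ g.ricci y (V y) (W y)) x (P.ζ x)
      = g.ricci x (g.leviCivita V x (P.ζ x)) (W x) + g.ricci x (V x) (g.leviCivita W x (P.ζ x))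
        + 2 * (g.ricci x (V x) (W x)
          - ((Module.finrank ℝ E : ℝ) - 1) * g.inner x (V x) (W x)) := by
  let L : TangentSpace I x →ₗ[ℝ] TangentSpace I x :=
    g.curvatureEnd x (g.leviCivita V x (P.ζ x)) (W x)
      + g.curvatureEnd x (V x) (g.leviCivita W x (P.ζ x))
      + (2 : ℝ) • (g.curvatureEnd x (V x) (W x) - (g.inner x (V x) (W x) • LinearMap.id
        - (g.inner x (W x)).toLinearMap.smulRight (V x)))
  have smooth (X) (hX : SmoothNear I X x) :
      ∀ᶠ y in 𝓝 x, g.curvatureEnd y (V y) (W y) (X y) = g.curvatureField X V W y := by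
    filter_upwards [hX.eventually, hV.eventually, hW.eventually] with y h1 h2 h3
    exact g.curvature_apply h1 h2 h3
  have h := g.d_trace (fun y ↦ g.curvatureEnd y (V y) (W y))
    (fun X hX ↦ (g.smooth_curvatureField hX hV hW).congr (smooth X hX)) (P.ζ x) L fun X hX ↦ by
      rw [g.leviCivita_congr (g.smooth_curvatureField hX hV hW) (smooth X hX)]
      have := hP.nabla_ζ_curvature hX hV hW
      simp only [L, LorentzianMetric.curvatureEnd, LinearMap.add_apply, LinearMap.smul_apply,
        LinearMap.sub_apply, LinearMap.coe_mk, AddHom.coe_mk, LinearMap.id_apply,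
        LinearMap.smulRight_apply, ContinuousLinearMap.coe_coe]
      rw [g.symm x (W x) (X x), ← this]
      abel
  simp only [← g.ricci_eq_trace] at h
  rw [h]
  simp only [L, map_add, map_sub, map_smul, LinearMap.trace_id, LinearMap.trace_smulRight,
    ← g.ricci_eq_trace, smul_eq_mul, ContinuousLinearMap.coe_coe]
  have : Module.finrank ℝ (TangentSpace I x) = Module.finrank ℝ E := rfl
  rw [this, g.symm x (W x) (V x)]
  ring

end LorentzianAlmostParacontact

namespace LorentzianAlmostParacontact

variable {E : Type*} [NormedAddCommGroup E] [NormedSpace ℝ E]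
  {H : Type*} [TopologicalSpace H] {I : ModelWithCorners ℝ E H}
  {M : Type*} [TopologicalSpace M] [ChartedSpace H M] [IsManifold I ∞ M]
  {g : LorentzianMetric I M} (P : LorentzianAlmostParacontact g) {x : M}

/-- In dimension at least two, the degenerate form `g + ν ⊗ ν` does not vanish. -/
theorem exists_inner_add_ν_mul_ν_ne_zero [FiniteDimensional ℝ E] (hn : 2 ≤ Module.finrank ℝ E)
    (x : M) : ∃ a b : TangentSpace I x, g.inner x a b + P.ν x a * P.ν x b ≠ 0 := by
  by_contra! h
  have span (a : TangentSpace I x) : a = (-P.ν x a) • P.ζ x := by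
    refine g.eq_of_inner_eq fun b ↦ ?_
    rw [map_smul, _root_.smul_apply, P.inner_ζ_left, smul_eq_mul]
    linarith [h a b]
  have : Module.finrank ℝ (TangentSpace I x) ≤ 1 :=
    finrank_le_one (P.ζ x) fun a ↦ ⟨_, (span a).symm⟩
  have h' : Module.finrank ℝ (TangentSpace I x) = Module.finrank ℝ E := rfl
  omega

variable [FiniteDimensional ℝ E] [CompleteSpace E] [Nontrivial E] {P} (hP : P.IsLPKenmotsu)
  {v : M → ℝ} {σ μ : ℝ}

include hP

/-- On an LP-Kenmotsu manifold, if `∇²v + σ S + μ g = 0` with constants `σ` and `μ`, then `dv`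
is proportional to `ν`, and so is the derivative of the proportionality factor. -/
theorem IsLPKenmotsu.d_potential (hv : ∀ x, SmoothFunNear I v x)
    (h : ∀ (x : M) (a b : TangentSpace I x),
      g.hessian v x a b + σ * g.ricci x a b + μ * g.inner x a b = 0)
    (x : M) (a : TangentSpace I x) :
    d% v x a = -(d% v x (P.ζ x)) * P.ν x a ∧
      d% (fun y ↦ d% v y (P.ζ y)) x a
        = -(μ + σ * ((Module.finrank ℝ E : ℝ) - 1)) * P.ν x a := by
  set κ := μ + σ * ((Module.finrank ℝ E : ℝ) - 1)
  set f : M → ℝ := fun y ↦ d% v y (P.ζ y)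
  have hf (x : M) : SmoothFunNear I f x := (hv x).d P.smooth_ζ
  have df (x : M) (a : TangentSpace I x) : d% f x a = -(d% v x a) - (f x + κ) * P.ν x a := by
    have e : f = fun y ↦ g.inner y (g.gradient v y) (P.ζ y) := by
      ext y; rw [g.inner_gradient]
    have h1 := h x a (P.ζ x)
    rw [hP.ricci_ζ, P.inner_ζ, LorentzianMetric.hessian] at h1
    have h2 := g.d_inner (g.smooth_gradient (hv x)) P.smooth_ζ a
    rw [← e, hP.leviCivita_ζ, map_sub, map_neg, map_smul, g.inner_gradient, g.inner_gradient,
      smul_eq_mul] at h2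
    rw [h2]
    simp only [f, κ]
    linear_combination h1
  have hζ := P.smooth_ζ (x := x)
  have symm : d% f x a * P.ν x (P.ζ x) = d% f x (P.ζ x) * P.ν x a := by
    have ha := SmoothNear.extend a
    have ax : (extend E a : Π y : M, TangentSpace I y) x = a := extend_apply_self ..
    set A : Π y : M, TangentSpace I y := extend E a
    have key {B : Π y : M, TangentSpace I y} (hB : SmoothNear I B x) (c : TangentSpace I x) :
        d% (fun y ↦ d% f y (B y)) x c = -(d% (fun y ↦ d% v y (B y)) x c)
          - ((f x + κ) * (P.ν x (g.leviCivita B x c) - g.inner x c (B x) - P.ν x c * P.ν x (B x))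
            + d% f x c * P.ν x (B x)) := by
      have e : (fun y ↦ d% f y (B y))
          = fun y ↦ -(d% v y (B y)) - (f y + κ) * P.ν y (B y) := by
        ext y; exact df y _
      have s1 := (hv x).d hB
      have s2 := (hf x).add (SmoothFunNear.const κ)
      have s3 := P.smooth_ν hB
      rw [e, mvfderiv_fun_sub s1.neg.mdifferentiableAt (s2.mul s3).mdifferentiableAt,
        mvfderiv_fun_neg, mvfderiv_fun_mul s2.mdifferentiableAt s3.mdifferentiableAt,
        mvfderiv_fun_add (hf x).mdifferentiableAt (SmoothFunNear.const κ).mdifferentiableAt,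
        mvfderiv_const]
      simp only [_root_.sub_apply, _root_.neg_apply, _root_.add_apply, _root_.smul_apply,
        smul_eq_mul, hP.d_ν hB, _root_.zero_apply]
      ring
    have b1 := d_mlieBracket (hf x) ha hζ
    have b2 := d_mlieBracket (hv x) ha hζ
    have br := g.nabla_sub_nabla ha hζ
    rw [key ha, key hζ, df, b2, ← br, LorentzianMetric.nabla, LorentzianMetric.nabla, ax,
      map_sub, g.symm x (P.ζ x) a] at b1
    linear_combination b1
  rw [P.ν_ζ_eq, df x (P.ζ x), P.ν_ζ_eq] at symm
  have h3 : d% f x a = -κ * P.ν x a := by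
    simp only [f] at symm ⊢
    linear_combination -symm
  refine ⟨?_, h3⟩
  have := df x a
  rw [h3] at this
  simp only [f] at this ⊢
  linear_combination this

theorem IsLPKenmotsu.ricci_of_hessian (hn : 2 ≤ Module.finrank ℝ E) (hσ : σ ≠ 0)
    (hv : ∀ x, SmoothFunNear I v x)
    (h : ∀ (x : M) (a b : TangentSpace I x),
      g.hessian v x a b + σ * g.ricci x a b + μ * g.inner x a b = 0) [Nonempty M] :
    μ = -σ * ((Module.finrank ℝ E : ℝ) - 1) ∧ ∀ (x : M) (a b : TangentSpace I x),
      g.ricci x a b = ((Module.finrank ℝ E : ℝ) - 1) * g.inner x a b := by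
  have hd := hP.d_potential hv h
  set κ := μ + σ * ((Module.finrank ℝ E : ℝ) - 1) with hκ
  set f : M → ℝ := fun y ↦ d% v y (P.ζ y)
  have hf (x : M) : SmoothFunNear I f x := (hv x).d P.smooth_ζ
  have grad : g.gradient v = -(f • P.ζ) := by
    ext y : 1
    refine g.eq_of_inner_eq fun b ↦ ?_
    rw [g.inner_gradient, (hd y b).1]
    simp [f, P.inner_ζ_left]
  have ric (x : M) (a b : TangentSpace I x) : σ * g.ricci x a b
      = -κ * (P.ν x a * P.ν x b) - f x * (g.inner x a b + P.ν x a * P.ν x b)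
        - μ * g.inner x a b := by
    have h1 := h x a b
    rw [LorentzianMetric.hessian, grad, g.leviCivita_neg (SmoothNear.smul (hf x) P.smooth_ζ),
      g.leviCivita_smul (hf x) P.smooth_ζ, hP.leviCivita_ζ, (hd x a).2] at h1
    simp only [map_sub, map_neg, map_add, map_smul, _root_.sub_apply,
      _root_.neg_apply, _root_.add_apply, _root_.smul_apply, smul_eq_mul, P.inner_ζ_left] at h1
    linear_combination h1
  have hκf (x : M) : κ + 2 * f x = 0 := by
    obtain ⟨a, b, hab⟩ := P.exists_inner_add_ν_mul_ν_ne_zero hn x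
    have ha := SmoothNear.extend a
    have hb := SmoothNear.extend b
    have ax : (extend E a : Π y : M, TangentSpace I y) x = a := extend_apply_self ..
    have bx : (extend E b : Π y : M, TangentSpace I y) x = b := extend_apply_self ..
    set A : Π y : M, TangentSpace I y := extend E a
    set B : Π y : M, TangentSpace I y := extend E b
    have d1 := hP.nabla_ζ_ricci ha hb
    have sν := (P.smooth_ν ha).mul (P.smooth_ν hb)
    have sg := g.smooth_inner ha hb
    have e : (fun y ↦ g.ricci y (A y) (B y))
        = fun y ↦ σ⁻¹ * (-κ * (P.ν y (A y) * P.ν y (B y))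
          - f y * (g.inner y (A y) (B y) + P.ν y (A y) * P.ν y (B y))
          - μ * g.inner y (A y) (B y)) := by
      ext y; rw [← ric, inv_mul_cancel_left₀ hσ]
    have c (r : ℝ) := SmoothFunNear.const (I := I) (x := x) r
    rw [e, mvfderiv_fun_mul (c _).mdifferentiableAt
        ((((c _).mul sν).sub ((hf x).mul (sg.add sν))).sub ((c _).mul sg)).mdifferentiableAt,
      mvfderiv_fun_sub (((c _).mul sν).sub ((hf x).mul (sg.add sν))).mdifferentiableAt
        ((c _).mul sg).mdifferentiableAt,
      mvfderiv_fun_sub ((c _).mul sν).mdifferentiableAt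
        ((hf x).mul (sg.add sν)).mdifferentiableAt,
      mvfderiv_fun_mul (c _).mdifferentiableAt sν.mdifferentiableAt,
      mvfderiv_fun_mul (c _).mdifferentiableAt sg.mdifferentiableAt,
      mvfderiv_fun_mul (hf x).mdifferentiableAt (sg.add sν).mdifferentiableAt,
      mvfderiv_fun_add sg.mdifferentiableAt sν.mdifferentiableAt,
      mvfderiv_fun_mul (P.smooth_ν ha).mdifferentiableAt (P.smooth_ν hb).mdifferentiableAt] at d1
    simp only [mvfderiv_const, _root_.sub_apply, _root_.add_apply, _root_.smul_apply, smul_eq_mul, smul_zero, add_zero, hP.d_ν ha,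
      hP.d_ν hb, g.d_inner ha hb, (hd x _).2, P.ν_ζ_eq, P.inner_ζ_left, ax, bx] at d1
    have r1 := ric x (g.leviCivita A x (P.ζ x)) b
    have r2 := ric x a (g.leviCivita B x (P.ζ x))
    have r3 := ric x a b
    have d2 := congrArg (σ * ·) d1
    simp only [← mul_assoc, mul_inv_cancel₀ hσ] at d2
    refine (mul_eq_zero.1 ?_).resolve_right hab
    linear_combination d2 + r1 + r2 + 2 * r3
  have hconst : f = fun _ ↦ -κ / 2 := by ext y; linarith [hκf y]
  have hκ0 : κ = 0 := by
    obtain ⟨x⟩ := ‹Nonempty M›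
    have := (hd x (P.ζ x)).2
    rw [hconst, mvfderiv_const, P.ν_ζ_eq] at this
    simpa using this.symm
  have hμ : μ = -σ * ((Module.finrank ℝ E : ℝ) - 1) := by linarith
  refine ⟨hμ, fun x a b ↦ mul_left_cancel₀ hσ ?_⟩
  have hfx : f x = 0 := by rw [hconst, hκ0]; simp
  rw [ric, hfx, hκ0, hμ]
  ring

end LorentzianAlmostParacontact

theorem LorentzianMetric.scalarCurvature_of_ricci
    {E : Type*} [NormedAddCommGroup E] [NormedSpace ℝ E] [FiniteDimensional ℝ E] [CompleteSpace E]
    {H : Type*} [TopologicalSpace H] {I : ModelWithCorners ℝ E H}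
    {M : Type*} [TopologicalSpace M] [ChartedSpace H M] [IsManifold I ∞ M]
    (g : LorentzianMetric I M) {c : ℝ} {x : M}
    (h : ∀ a b : TangentSpace I x, g.ricci x a b = c * g.inner x a b) :
    g.scalarCurvature x = c * Module.finrank ℝ E := by
  have h1 (i) : g.ricci x (Module.finBasis ℝ (TangentSpace I x) i) (g.sharp x
      (LinearMap.toContinuousLinearMap ((Module.finBasis ℝ (TangentSpace I x)).coord i))) = c := by
    rw [h, g.symm, g.inner_sharp]
    simp
  have h2 : Module.finrank ℝ (TangentSpace I x) = Module.finrank ℝ E := rfl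
  simp only [scalarCurvature, h1]
  simp [h2, mul_comm]

end

theorem corollary4p3 {n : ℕ} (hn : 2 ≤ n) {M : Type*} [TopologicalSpace M]
    [ChartedSpace (EuclideanSpace ℝ (Fin n)) M] [IsManifold (𝓡 n) ∞ M] [Nonempty M]
    (g : LorentzianMetric (𝓡 n) M) (P : LorentzianAlmostParacontact g) (hP : P.IsLPKenmotsu)
    (hr : ∃ r : ℝ, ∀ x : M, g.scalarCurvature x = r) :
    (∀ (v : M → ℝ) (σ ρ Λ : ℝ), σ ≠ 0 → g.IsGradientRicciYamabeSoliton v σ ρ Λ →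
      g.IsEinstein ∧ Λ = ρ * (n * (n - 1)) / 2 - σ * (n - 1)) ∧
    (∀ (v : M → ℝ) (Λ : ℝ), g.IsGradientRicciSoliton v Λ → Λ = -((n : ℝ) - 1) ∧ Λ < 0) ∧
    (∀ (v : M → ℝ) (Λ : ℝ), g.IsGradientEinsteinSoliton v Λ →
      Λ = -(((n : ℝ) - 1) * (n + 2)) / 2 ∧ Λ < 0) := by
  have hn' : (2 : ℝ) ≤ n := by exact_mod_cast hn
  have hfin : Module.finrank ℝ (EuclideanSpace ℝ (Fin n)) = n := by simp
  have : Nontrivial (EuclideanSpace ℝ (Fin n)) :=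
    Module.nontrivial_of_finrank_pos (R := ℝ) (by omega)
  have main (v : M → ℝ) (σ ρ Λ : ℝ) (hσ : σ ≠ 0) (h : g.IsGradientRicciYamabeSoliton v σ ρ Λ) :
      g.IsEinstein ∧ Λ = ρ * (n * (n - 1)) / 2 - σ * (n - 1) := by
    obtain ⟨r, hr⟩ := hr
    have hv (x : M) : SmoothFunNear (𝓡 n) v x :=
      Filter.Eventually.of_forall fun y ↦ h.contMDiff y
    obtain ⟨hμ, hric⟩ := hP.ricci_of_hessian (μ := Λ - ρ * r / 2) (by omega) hσ hv
      fun x a b ↦ by simpa only [hr] using h.equation x a b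
    rw [hfin] at hμ hric
    refine ⟨⟨n - 1, by linarith, hric⟩, ?_⟩
    obtain ⟨x⟩ := ‹Nonempty M›
    have hrn := g.scalarCurvature_of_ricci (hric x)
    rw [hr, hfin] at hrn
    rw [hrn] at hμ
    linarith
  refine ⟨main, fun v Λ h ↦ ?_, fun v Λ h ↦ ?_⟩
  · have := (main v 1 0 Λ one_ne_zero h).2
    constructor <;> linarith
  · have := (main v 1 (-1) Λ one_ne_zero h).2
    have e : Λ = -(((n : ℝ) - 1) * (n + 2)) / 2 := by rw [this]; ring
    exact ⟨e, by rw [e]; nlinarith⟩
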